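/- Let $A$ be a finite-dimensional associative unital real algebra with unit $e_0$ (equipped with an algebra norm), let $p\ge 0$, and put $q=p$, $n=p+1$. Let $\alpha_1,\dots,\alpha_p\in A$, let $\beta_1,\dots,\beta_p$ be invertible elements of $A$, and define coefficients $a^j_m\in A$ ($0\le j\le p$, $1\le m\le p$) by $a^0_m=\alpha_m$, $a^m_m=\beta_m$ and $a^j_m=0$ for $1\le j\ne m$; that is, the $(p+1)\times p$ coefficient matrix has first row $(\alpha_1,\dots,\alpha_p)$, and its last $p$ rows form the diagonal matrix with diagonal entries $\beta_1,\dots,\beta_p$. Put $\gamma_m=\alpha_m\beta_m^{-1}$. Assume that $$e_0+\sum_{m=1}^p\gamma_m^2\in I,$$ where $I$ is the right ideal of $A$ generated by the commutators $\gamma_m\gamma_k-\gamma_k\gamma_m$, $1\le k<m\le p$. Then the Cauchy functions for these coefficients satisfy a Cauchy formula: there are elements $b^i_m\in A$ ($0\le i\le p$, $1\le m\le p$) such that, with $\varphi_m(x,y)=\sum_{i=0}^p b^i_m(y_i-x_i)$, for every bounded open set $D\subset\mathbb R^{p+1}$ with $C^\infty$ boundary, every function $f:\overline D\to A$ that is continuous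 on $\overline D$, of class $C^1$ on $D$, and satisfies $$\sum_{j=0}^{p}\frac{\partial f}{\partial x_j}\,a^j_m=0\quad\text{on }D,\qquad m=1,\dots,p,$$ and every $x\in D$, the following integral converges absolutely and $$f(x)=\int_{\partial D}f(y)\sum_{m=1}^{p}\Big(\sum_{j=0}^{p}a^j_m\frac{\partial}{\partial y_j}\Big)\lrcorner\Big(\frac{\varphi_m(x,y)}{\|y-x\|^{p+1}}\,dV(y)\Big) =\int_{\partial D}f(y)\sum_{m=1}^{p}\sum_{j=0}^{p}\nu_j(y)\,a^j_m\,\frac{\varphi_m(x,y)}{\|y-x\|^{p+1}}\,d\sigma(y).$$ Here $\|\cdot\|$ is the Euclidean norm, $dV=dy_0\wedge\dots\wedge dy_p$, $\nu$ is the outward unit normal and $\sigma$ the surface measure of $\partial D$. -/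

import Mathlib

open MeasureTheory
open scoped ContDiff

namespace CauchyAlgebra

/-- `ρ` is a smooth defining function of the open set `D` on the open set `U`:
`D ∩ U = {ρ < 0}`, and the gradient of `ρ` has no zero on `U`. -/
structure IsLocalDefiningFunction {n : ℕ} (D U : Set (EuclideanSpace ℝ (Fin n)))
    (ρ : EuclideanSpace ℝ (Fin n) → ℝ) : Prop where
  isOpen : IsOpen U
  contDiffOn : ContDiffOn ℝ ∞ ρ U
  gradient_ne_zero : ∀ y ∈ U, gradient ρ y ≠ 0
  inter_eq : D ∩ U = {y ∈ U | ρ y < 0}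

/-- `D` is a bounded open subset of `ℝⁿ` with smooth (`C^∞`) boundary. Connectedness is not
required. -/
structure IsSmoothBoundedDomain {n : ℕ} (D : Set (EuclideanSpace ℝ (Fin n))) : Prop where
  isOpen : IsOpen D
  isBounded : Bornology.IsBounded D
  exists_defining : ∀ y ∈ frontier D, ∃ (U : Set (EuclideanSpace ℝ (Fin n)))
    (ρ : EuclideanSpace ℝ (Fin n) → ℝ), y ∈ U ∧ IsLocalDefiningFunction D U ρ

/-- `v` is the normalized gradient `∇ρ / ‖∇ρ‖` at `y` of a local defining function of `D`. -/
def IsOutwardNormal {n : ℕ} (D : Set (EuclideanSpace ℝ (Fin n)))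
    (y v : EuclideanSpace ℝ (Fin n)) : Prop :=
  ∃ (U : Set (EuclideanSpace ℝ (Fin n))) (ρ : EuclideanSpace ℝ (Fin n) → ℝ),
    y ∈ U ∧ IsLocalDefiningFunction D U ρ ∧ v = ‖gradient ρ y‖⁻¹ • gradient ρ y

/-- The outward unit normal vector of `D` at a boundary point `y`. It does not depend on the
defining function, see `IsOutwardNormal.unique`. -/
noncomputable def outwardNormal {n : ℕ} (D : Set (EuclideanSpace ℝ (Fin n)))
    (y : EuclideanSpace ℝ (Fin n)) : EuclideanSpace ℝ (Fin n) :=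
  Classical.epsilon (IsOutwardNormal D y)

theorem IsLocalDefiningFunction.eq_zero {n : ℕ} {D U : Set (EuclideanSpace ℝ (Fin n))}
    {ρ : EuclideanSpace ℝ (Fin n) → ℝ} (hD : IsOpen D) (h : IsLocalDefiningFunction D U ρ)
    {y : EuclideanSpace ℝ (Fin n)} (hy : y ∈ frontier D) (hyU : y ∈ U) : ρ y = 0 := by
  rw [hD.frontier_eq] at hy
  apply le_antisymm
  · by_contra hpos
    push Not at hpos
    have hc : ContinuousAt ρ y := (h.contDiffOn.continuousOn).continuousAt (h.isOpen.mem_nhds hyU)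
    have hev : ∀ᶠ z in nhds y, 0 < ρ z ∧ z ∈ U :=
      (hc.eventually (lt_mem_nhds hpos)).and (h.isOpen.mem_nhds hyU)
    obtain ⟨z, ⟨hz, hzU⟩, hzD⟩ := mem_closure_iff_nhds.1 hy.1 _ hev
    have : z ∈ {y ∈ U | ρ y < 0} := h.inter_eq ▸ ⟨hzD, hzU⟩
    exact absurd this.2 (not_lt.2 hz.le)
  · by_contra hneg
    push Not at hneg
    have : y ∈ D ∩ U := h.inter_eq ▸ ⟨hyU, hneg⟩
    exact hy.2 this.1

theorem IsLocalDefiningFunction.hasDerivAt_line {n : ℕ} {D U : Set (EuclideanSpace ℝ (Fin n))}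
    {ρ : EuclideanSpace ℝ (Fin n) → ℝ} (h : IsLocalDefiningFunction D U ρ)
    {y : EuclideanSpace ℝ (Fin n)} (hyU : y ∈ U) (v : EuclideanSpace ℝ (Fin n)) :
    HasDerivAt (fun t : ℝ => ρ (y + t • v)) (inner ℝ (gradient ρ y) v) 0 := by
  have hd : DifferentiableAt ℝ ρ y :=
    ((h.contDiffOn y hyU).contDiffAt (h.isOpen.mem_nhds hyU)).differentiableAt (by simp)
  have h1 : HasFDerivAt ρ (InnerProductSpace.toDual ℝ _ (gradient ρ y)) (y + (0 : ℝ) • v) := by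
    simpa using hd.hasGradientAt.hasFDerivAt
  have h2 : HasDerivAt (fun t : ℝ => y + t • v) v 0 := by
    simpa using ((hasDerivAt_id (0 : ℝ)).smul_const v).const_add y
  have h3 := h1.comp_hasDerivAt (0 : ℝ) h2
  rw [InnerProductSpace.toDual_apply_apply] at h3
  exact h3

/-- The outward unit normal is well defined. -/
theorem IsOutwardNormal.unique {n : ℕ} {D : Set (EuclideanSpace ℝ (Fin n))} (hD : IsOpen D)
    {y : EuclideanSpace ℝ (Fin n)} (hy : y ∈ frontier D) {v w : EuclideanSpace ℝ (Fin n)}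
    (hv : IsOutwardNormal D y v) (hw : IsOutwardNormal D y w) : v = w := by
  obtain ⟨U, ρ, hyU, h, rfl⟩ := hv
  obtain ⟨V, σ, hyV, h', rfl⟩ := hw
  set g := gradient ρ y with hg
  set k := gradient σ y with hk
  have hgn : 0 < ‖g‖ := norm_pos_iff.2 (h.gradient_ne_zero y hyU)
  have hkn : 0 < ‖k‖ := norm_pos_iff.2 (h'.gradient_ne_zero y hyV)
  have key : ∀ u, inner ℝ g u < 0 → inner ℝ k u ≤ 0 := by
    intro u hu
    by_contra hpos
    push Not at hpos
    have d1 := h.hasDerivAt_line hyU u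
    have d2 := h'.hasDerivAt_line hyV u
    have hcont : ContinuousAt (fun t : ℝ => y + t • u) 0 := by fun_prop
    have e1 : ∀ᶠ t in nhdsWithin (0 : ℝ) (Set.Ioi 0), y + t • u ∈ U ∩ V := by
      apply (hcont.eventually (p := fun z => z ∈ U ∩ V) _).filter_mono nhdsWithin_le_nhds
      simpa using (h.isOpen.inter h'.isOpen).mem_nhds ⟨hyU, hyV⟩
    have s1 := (hasDerivAt_iff_tendsto_slope_zero.1 d1).mono_left
      (nhdsWithin_mono (0 : ℝ) (fun t (ht : t ∈ Set.Ioi (0 : ℝ)) => ne_of_gt ht))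
    have s2 := (hasDerivAt_iff_tendsto_slope_zero.1 d2).mono_left
      (nhdsWithin_mono (0 : ℝ) (fun t (ht : t ∈ Set.Ioi (0 : ℝ)) => ne_of_gt ht))
    have e2 := s1.eventually (gt_mem_nhds hu)
    have e3 := s2.eventually (lt_mem_nhds hpos)
    have e0 : ∀ᶠ t in nhdsWithin (0 : ℝ) (Set.Ioi 0), t ∈ Set.Ioi (0 : ℝ) := self_mem_nhdsWithin
    obtain ⟨t, ⟨⟨ht, htUV⟩, ht2⟩, ht3⟩ := (((e0.and e1).and e2).and e3).exists
    have ht' : (0 : ℝ) < t := ht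
    simp only [zero_add, zero_smul, add_zero, h.eq_zero hD hy hyU, h'.eq_zero hD hy hyV, sub_zero,
      smul_eq_mul] at ht2 ht3
    have r1 : ρ (y + t • u) < 0 := by
      by_contra hc
      push Not at hc
      exact absurd ht2 (not_lt.2 (mul_nonneg (inv_nonneg.2 ht'.le) hc))
    have hmem : y + t • u ∈ D ∩ U := h.inter_eq ▸ ⟨htUV.1, r1⟩
    have hmem' : y + t • u ∈ {y ∈ V | σ y < 0} := h'.inter_eq ▸ ⟨hmem.1, htUV.2⟩
    exact absurd ht3 (not_lt.2
      (mul_nonpos_of_nonneg_of_nonpos (inv_nonneg.2 ht'.le) hmem'.2.le))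
  set a := ‖g‖⁻¹ • g with ha
  set b := ‖k‖⁻¹ • k with hb
  have na : ‖a‖ = 1 := by simp [ha, norm_smul, hgn.ne']
  have nb : ‖b‖ = 1 := by simp [hb, norm_smul, hkn.ne']
  have ga : g = ‖g‖ • a := by simp [ha, smul_smul, hgn.ne']
  have kb : k = ‖k‖ • b := by simp [hb, smul_smul, hkn.ne']
  by_contra hne
  have hlt : inner ℝ a b < 1 := (inner_lt_one_iff_real_of_norm_eq_one na nb).2 hne
  have h1 : inner ℝ g (b - a) < 0 := by
    rw [ga, real_inner_smul_left, inner_sub_right, real_inner_self_eq_norm_sq, na]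
    nlinarith
  have h2 := key _ h1
  rw [kb, real_inner_smul_left, inner_sub_right, real_inner_self_eq_norm_sq, nb,
    real_inner_comm] at h2
  nlinarith

/-- The functions on the closure of `D` with values in `A`, continuous on the closure and `C¹` on
`D`, that satisfy the `q` Cauchy conditions `∑ j, (∂f/∂xⱼ) aʲₘ = 0` on `D`. The entry `a j m` of
the matrix `a` is the coefficient `aʲₘ`. -/
structure IsCauchyFunction {n q : ℕ} {A : Type*} [NormedRing A] [NormedAlgebra ℝ A]
    (a : Matrix (Fin n) (Fin q) A) (D : Set (EuclideanSpace ℝ (Fin n)))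
    (f : EuclideanSpace ℝ (Fin n) → A) : Prop where
  continuousOn : ContinuousOn f (closure D)
  contDiffOn : ContDiffOn ℝ 1 f D
  cauchy : ∀ y ∈ D, ∀ m : Fin q,
    ∑ j : Fin n, fderiv ℝ f y (EuclideanSpace.single j 1) * a j m = 0

/-- The linear functions `φₘ(x, y) = ∑ i, bⁱₘ (yᵢ - xᵢ)`. -/
noncomputable def phi {n q : ℕ} {A : Type*} [NormedRing A] [NormedAlgebra ℝ A]
    (b : Matrix (Fin n) (Fin q) A) (m : Fin q) (x y : EuclideanSpace ℝ (Fin n)) : A :=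
  ∑ i : Fin n, (y i - x i) • b i m

/-- The density with respect to the surface measure of `∂D` of the restriction to `∂D` of the
`(n-1)`-form `∑ m, (∑ j, aʲₘ ∂/∂yⱼ) ⌟ (φₘ(x, y) / ‖y - x‖ⁿ dV)`: the restriction of
`∂/∂yⱼ ⌟ dV` to `∂D` is `νⱼ dσ`, where `ν` is the outward unit normal. -/
noncomputable def cauchyKernel {n q : ℕ} {A : Type*} [NormedRing A] [NormedAlgebra ℝ A]
    (a b : Matrix (Fin n) (Fin q) A) (D : Set (EuclideanSpace ℝ (Fin n)))
    (x y : EuclideanSpace ℝ (Fin n)) : A :=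
  ∑ m : Fin q, ∑ j : Fin n,
    outwardNormal D y j • (a j m * ((‖y - x‖ ^ n)⁻¹ • phi b m x y))

/-- The Cauchy functions for the coefficients `a` satisfy a Cauchy formula: there are linear
`φₘ`, depending only on `a`, such that
`f x = ∫_{∂D} f(y) ∑ m, (∑ j, aʲₘ ∂/∂yⱼ) ⌟ (φₘ(x, y) / ‖y - x‖ⁿ dV)`
for every bounded `D` with smooth boundary, every Cauchy function `f` on `D` and every `x ∈ D`.
The surface measure of `∂D` is the Euclidean `(n-1)`-dimensional Hausdorff measure. -/
def HasCauchyFormula {n q : ℕ} {A : Type*} [NormedRing A] [NormedAlgebra ℝ A]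
    (a : Matrix (Fin n) (Fin q) A) : Prop :=
  ∃ b : Matrix (Fin n) (Fin q) A,
    ∀ D : Set (EuclideanSpace ℝ (Fin n)), IsSmoothBoundedDomain D →
    ∀ f : EuclideanSpace ℝ (Fin n) → A, IsCauchyFunction a D f →
    ∀ x ∈ D,
      IntegrableOn (fun y => f y * cauchyKernel a b D x y) (frontier D)
        (Measure.euclideanHausdorffMeasure (n - 1)) ∧
      f x = ∫ y in frontier D, f y * cauchyKernel a b D x y
        ∂(Measure.euclideanHausdorffMeasure (n - 1))

/-- The matrix with `p + 1` rows and `p` columns whose first row is `(α₁, …, αₚ)` and whose last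
`p` rows form the diagonal matrix with diagonal entries `β₁, …, βₚ`. -/
def specialCoeff {p : ℕ} {A : Type*} [Ring A] (α : Fin p → A) (β : Fin p → Aˣ) :
    Matrix (Fin (p + 1)) (Fin p) A :=
  Matrix.of (Fin.cons α (fun k m => if k = m then (β k : A) else 0))

/-- The right ideal of `A` generated by the commutators `γₘ γₖ - γₖ γₘ`, `k < m`. -/
def commutatorRightIdeal {p : ℕ} {A : Type*} [Ring A] (γ : Fin p → A) : Submodule Aᵐᵒᵖ A :=
  Submodule.span Aᵐᵒᵖ {c : A | ∃ k m : Fin p, k < m ∧ c = γ m * γ k - γ k * γ m}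

end CauchyAlgebra

/-!
The Cauchy formula for the coefficients `specialCoeff α β`.

Put `ψⱼ(h) = ∑ m, aʲₘ φₘ(h)`, a linear vector field with values in `A`. For a Cauchy function `f`,
the divergence of `f ψ(y - x) / ‖y - x‖ⁿ` contains no derivative of `f`, since
`∑ j, (∂f/∂yⱼ) ψⱼ = ∑ m, (∑ j, (∂f/∂yⱼ) aʲₘ) φₘ = 0`. If moreover the matrix of `ψ` is
`c` times the identity plus an antisymmetric matrix (`IsConformalPair`), then
`∑ j, hⱼ ψⱼ(h) = c ‖h‖²` and the divergence of `ψ` is `n c`, just as for the radial field `c h`. For the regularized kernel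
`(ε² + ‖y - x‖²) ^ (-n / 2)` in place of `‖y - x‖⁻ⁿ`, the divergence therefore equals
`n c ε² (ε² + ‖y - x‖²) ^ (-(n + 2) / 2) f` (`divergence_regularized`), which is an approximate
identity applied to `f` for the right constant `c` (`tendsto_integral_peak`). The divergence theorem
on all of `D` and the limit `ε → 0` give the formula (`hasCauchyFormula_of_isConformalPair`).

It remains to choose the `φₘ`. The rows `1, …, p` of the matrix of `ψ` can be prescribed, because
the `βₘ` are invertible, and the row `0` is then `∑ m, γₘ ψₘ`. If the block of the rows and columns
`1, …, p` is `c (1 + S)` with `S` antisymmetric, antisymmetry determines the column `0` from the row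
`0`, and the only condition left is that the entry `(0, 0)` be `c`, which reads
`1 + ∑ m, γₘ² = ∑ k m, γₖ γₘ Sₖₘ`. Such an `S` exists exactly when the left side is in the right
ideal generated by the commutators (`exists_isConformalPair_specialCoeff`).

The divergence theorem, for the surface measure given by the Hausdorff measure, is proved in the
form `IsFlatDomain.gaussGreen` first. Near a boundary point, `D` is the region below a graph with
small Lipschitz constant over the tangent hyperplane. The fundamental theorem of calculus on the
lines parallel to the normal `ν` computes the integral of the derivative `∂u/∂ν`; Lipschitz bounds
in both directions compare the Lebesgue measure of the tangent hyperplane with the surface measure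
(`IsFlatAt.integral_fderiv_normal`). For a nearly tangential direction `w` that points out of `D`,
the integral of `∂u/∂w` is nonnegative when `u ≥ 0`, because translation by `w` enlarges `D`
(`integral_fderiv_nonneg_of_shift`); this shows that the integrals of tangential derivatives are
small. So the Gauss–Green formula holds locally up to an error of the form `C ε ∫ u dσ`; a partition
of unity adds these errors up to `C ε ∫ u dσ`, and `ε` is arbitrary. For fields that are of class
`C¹` only in the interior, the formula is applied locally to their translates into the domain
(`IsFlatDomain.divergence_theorem`).
-/

namespace CauchyAlgebra

/-! ### Derivatives along a direction integrated over a set -/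

section Translation

open Filter Topology Set
open scoped RealInnerProductSpace

variable {E : Type*} [NormedAddCommGroup E] [InnerProductSpace ℝ E] [FiniteDimensional ℝ E]
  [MeasurableSpace E] [BorelSpace E]

theorem integrable_fderiv_apply {u : E → ℝ} (hu : ContDiff ℝ 1 u) (hc : HasCompactSupport u)
    (v : E) : Integrable (fun y => fderiv ℝ u y v) :=
  Continuous.integrable_of_hasCompactSupport
    ((hu.continuous_fderiv (by simp)).clm_apply continuous_const)
    ((hc.fderiv (𝕜 := ℝ)).mono fun x hx => by
      intro h; apply hx; simp [h])

/-- Differentiation of `t ↦ ∫ y in D, u (y + t w)` under the integral sign. -/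
theorem hasDerivAt_integral_comp_add_smul {D : Set E} (hDb : volume D ≠ ⊤) {u : E → ℝ}
    (hu : ContDiff ℝ 1 u) (hc : HasCompactSupport u) (w : E) :
    HasDerivAt (fun t : ℝ => ∫ y in D, u (y + t • w)) (∫ y in D, fderiv ℝ u y w) 0 := by
  have : IsFiniteMeasure (volume.restrict D) := ⟨by simpa using hDb.lt_top⟩
  obtain ⟨C, hC⟩ := hu.lipschitzWith_of_hasCompactSupport hc one_ne_zero
  refine (hasDerivAt_integral_of_dominated_loc_of_lip (μ := volume.restrict D)
    (F := fun t y => u (y + t • w)) (F' := fun y => fderiv ℝ u y w) (x₀ := (0 : ℝ))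
    (s := univ) (bound := fun _ => C * ‖w‖) univ_mem ?_ ?_ ?_ ?_ (integrable_const _) ?_).2
  · exact Eventually.of_forall fun t =>
      (hu.continuous.comp (by fun_prop : Continuous fun y : E => y + t • w)).aestronglyMeasurable
  · simpa [IntegrableOn] using
      (hu.continuous.integrable_of_hasCompactSupport hc).integrableOn (s := D)
  · exact (integrable_fderiv_apply hu hc w).aestronglyMeasurable.restrict
  · refine Eventually.of_forall fun y => ?_
    refine LipschitzOnWith.of_dist_le_mul fun s _ t _ => ?_
    refine (hC.dist_le_mul _ _).trans ?_
    rw [dist_add_left, dist_eq_norm, ← sub_smul, norm_smul, Real.dist_eq, ← Real.norm_eq_abs]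
    simp only [Real.coe_nnabs, abs_mul, abs_norm, NNReal.abs_eq]
    exact le_of_eq (by ring)
  · refine Eventually.of_forall fun y => ?_
    have h1 : HasFDerivAt u (fderiv ℝ u y) (y + (0 : ℝ) • w) := by
      simpa using (hu.differentiable (by simp) y).hasFDerivAt
    have h2 : HasDerivAt (fun t : ℝ => y + t • w) w 0 := by
      simpa using ((hasDerivAt_id (0 : ℝ)).smul_const w).const_add y
    exact h1.comp_hasDerivAt (0 : ℝ) h2

/-- If small translations by `-t w` map the part of `D` on which `u` lives into `D`, then
translating `D` by `t w` increases the integral of `u ≥ 0`, so that the integral of the derivative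
of `u` in the direction `w` is nonnegative. -/
theorem integral_fderiv_nonneg_of_shift {D : Set E} (hD : MeasurableSet D) (hDb : volume D ≠ ⊤)
    {u : E → ℝ} (hu : ContDiff ℝ 1 u) (hc : HasCompactSupport u) (h0 : ∀ y, 0 ≤ u y) {w : E}
    (h : ∀ᶠ t : ℝ in 𝓝[>] 0, ∀ y ∈ D, u y ≠ 0 → y - t • w ∈ D) :
    0 ≤ ∫ y in D, fderiv ℝ u y w := by
  have hd := hasDerivAt_integral_comp_add_smul hDb hu hc w
  have s1 := (hasDerivAt_iff_tendsto_slope_zero.1 hd).mono_left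
      (nhdsWithin_mono (0 : ℝ) (fun t (ht : t ∈ Ioi (0 : ℝ)) => ne_of_gt ht))
  refine ge_of_tendsto s1 ?_
  filter_upwards [h, self_mem_nhdsWithin] with t ht ht0
  have ht0' : (0 : ℝ) < t := ht0
  refine smul_nonneg (inv_nonneg.2 ht0'.le) (sub_nonneg.2 ?_)
  have hi := hu.continuous.integrable_of_hasCompactSupport hc (μ := volume)
  rw [zero_add, ← integral_indicator hD, ← integral_indicator hD]
  have e : ∫ y, D.indicator (fun y => u (y + t • w)) y
      = ∫ z, D.indicator (fun y => u (y + t • w)) (z - t • w) :=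
    (integral_sub_right_eq_self _ _).symm
  rw [e]
  -- Both integrals are now over the whole space, with integrands `1_D(z) u(z) ≤ 1_D(z - t w) u(z)`.
  have hi' : Integrable (fun z => D.indicator (fun y => u (y + t • w)) (z - t • w)) volume :=
    ((hi.comp_add_right (t • w)).indicator hD).comp_sub_right (t • w)
  refine integral_mono ?_ hi' fun z => ?_
  · simpa using hi.indicator hD
  · by_cases hz : z ∈ D
    · by_cases huz : u z = 0
      · simp only [zero_smul, add_zero, indicator_of_mem hz, huz]
        exact indicator_nonneg (fun _ _ => h0 _) _
      · simp [indicator_of_mem hz, indicator_of_mem (ht z hz huz)]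
    · rw [indicator_of_notMem hz]
      exact indicator_nonneg (fun _ _ => h0 _) _

/-- Orthogonal coordinates at `y₀`: the height along the unit vector `ν` and the component in the
hyperplane orthogonal to `ν`. -/
noncomputable def heightCoord {ν : E} (hν : ‖ν‖ = 1) (y₀ : E) : (ℝ × (ℝ ∙ ν)ᗮ) ≃ᵐ E :=
  ((LinearIsometryEquiv.toSpanUnitSingleton ν hν).toMeasurableEquiv.prodCongr
    (MeasurableEquiv.refl _)).trans ((ℝ ∙ ν).measurableEquivProd y₀).symm

theorem heightCoord_apply {ν : E} (hν : ‖ν‖ = 1) (y₀ : E) (q : ℝ × (ℝ ∙ ν)ᗮ) :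
    heightCoord hν y₀ q = y₀ + (q.1 • ν + q.2) := by
  simp only [heightCoord, MeasurableEquiv.trans_apply]
  rw [Submodule.measurableEquivProd_symm_apply, vadd_eq_add, add_comm]
  rfl

theorem measurePreserving_heightCoord {ν : E} (hν : ‖ν‖ = 1) (y₀ : E) :
    MeasurePreserving (heightCoord hν y₀) volume volume := by
  have h1 := ((ℝ ∙ ν).measurePreserving_measurableEquivProd y₀).symm
  rw [InnerProductSpace.euclideanHausdorffMeasure_eq_volume] at h1
  exact ((LinearIsometryEquiv.toSpanUnitSingleton ν hν).measurePreserving.prod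
    (MeasurePreserving.id _)).trans h1

end Translation

/-! ### Open sets with nearly flat boundary -/

section Graph

open Filter Topology Set
open scoped RealInnerProductSpace

variable {E : Type*} [NormedAddCommGroup E] [InnerProductSpace ℝ E]

/-- On the ball of radius `r` about `y₀`, the set `D` is `{ρ < 0}`, where `ρ y₀ = 0` and `ρ` differs
from the linear function `⟪ν, ·⟫`, with `ν` a unit vector, by a function with Lipschitz constant
`ε < 1`. -/
structure IsFlatAt (D : Set E) (ρ : E → ℝ) (y₀ ν : E) (ε r : ℝ) : Prop where
  norm_eq : ‖ν‖ = 1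
  nonneg : 0 ≤ ε
  lt_one : ε < 1
  pos : 0 < r
  approx : ∀ x ∈ Metric.ball y₀ r, ∀ y ∈ Metric.ball y₀ r,
    |ρ x - ρ y - ⟪ν, x - y⟫| ≤ ε * ‖x - y‖
  zero : ρ y₀ = 0
  mem_iff : ∀ x ∈ Metric.ball y₀ r, x ∈ D ↔ ρ x < 0

variable {D : Set E} {ρ : E → ℝ} {y₀ ν : E} {ε r : ℝ}

namespace IsFlatAt

theorem continuousOn (h : IsFlatAt D ρ y₀ ν ε r) : ContinuousOn ρ (Metric.ball y₀ r) := by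
  have : LipschitzOnWith (Real.toNNReal (1 + ε)) ρ (Metric.ball y₀ r) := by
    refine LipschitzOnWith.of_dist_le_mul fun x hx y hy => ?_
    rw [Real.coe_toNNReal _ (by linarith [h.nonneg]), Real.dist_eq, dist_eq_norm]
    have h1 := h.approx x hx y hy
    have h2 := abs_real_inner_le_norm ν (x - y)
    rw [h.norm_eq, one_mul] at h2
    rw [abs_le] at *
    constructor <;> nlinarith [h1.1, h1.2, h2.1, h2.2]
  exact this.continuousOn

/-- Moving by `w` with `ε ‖w‖ ≤ -⟪ν, w⟫` does not increase `ρ`. -/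
theorem le_of_cone (h : IsFlatAt D ρ y₀ ν ε r) {x w : E} (hx : x ∈ Metric.ball y₀ r)
    (hxw : x - w ∈ Metric.ball y₀ r) (hw : ε * ‖w‖ ≤ ⟪ν, w⟫) : ρ (x - w) ≤ ρ x := by
  have h1 := h.approx x hx (x - w) hxw
  rw [sub_sub_cancel] at h1
  linarith [(abs_le.1 h1).1]

theorem lt_of_cone (h : IsFlatAt D ρ y₀ ν ε r) {x w : E} (hx : x ∈ Metric.ball y₀ r)
    (hxw : x - w ∈ Metric.ball y₀ r) (hw : ε * ‖w‖ < ⟪ν, w⟫) : ρ (x - w) < ρ x := by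
  have h1 := h.approx x hx (x - w) hxw
  rw [sub_sub_cancel] at h1
  linarith [(abs_le.1 h1).1]

theorem mem_frontier_iff (h : IsFlatAt D ρ y₀ ν ε r) (hD : IsOpen D) {x : E}
    (hx : x ∈ Metric.ball y₀ r) : x ∈ frontier D ↔ ρ x = 0 := by
  have hc : ContinuousAt ρ x := h.continuousOn.continuousAt (Metric.isOpen_ball.mem_nhds hx)
  rw [hD.frontier_eq]
  constructor
  · rintro ⟨hx1, hx2⟩
    rw [h.mem_iff x hx, not_lt] at hx2
    refine le_antisymm (not_lt.1 fun hpos => ?_) hx2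
    obtain ⟨z, ⟨hz, hzb⟩, hzD⟩ := mem_closure_iff_nhds.1 hx1 _
      ((hc.eventually (lt_mem_nhds hpos)).and (Metric.isOpen_ball.mem_nhds hx))
    exact absurd ((h.mem_iff z hzb).1 hzD) (not_lt.2 (le_of_lt hz))
  · intro h0
    refine ⟨?_, fun hxD => by simpa [h0] using (h.mem_iff x hx).1 hxD⟩
    have ht : Tendsto (fun t : ℝ => x - t • ν) (𝓝[>] 0) (𝓝 x) := by
      have : ContinuousAt (fun t : ℝ => x - t • ν) 0 := by fun_prop
      simpa [ContinuousAt] using this.mono_left nhdsWithin_le_nhds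
    refine mem_closure_of_tendsto ht ?_
    filter_upwards [ht.eventually (Metric.isOpen_ball.mem_nhds hx), self_mem_nhdsWithin]
      with t htb ht0
    have ht0' : (0 : ℝ) < t := ht0
    rw [h.mem_iff _ htb, ← h0]
    refine h.lt_of_cone hx htb ?_
    rw [real_inner_smul_right, real_inner_self_eq_norm_sq, norm_smul, h.norm_eq, Real.norm_eq_abs,
      abs_of_pos ht0']
    nlinarith [h.lt_one]

theorem inner_height (h : IsFlatAt D ρ y₀ ν ε r) (s : ℝ) (x : (ℝ ∙ ν)ᗮ) :
    ⟪ν, s • ν + (x : E)⟫ = s := by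
  rw [inner_add_right, real_inner_smul_right, real_inner_self_eq_norm_sq, h.norm_eq,
    Submodule.mem_orthogonal_singleton_iff_inner_right.1 x.2]
  ring

theorem norm_height_le (h : IsFlatAt D ρ y₀ ν ε r) (s : ℝ) (x : (ℝ ∙ ν)ᗮ) :
    ‖s • ν + (x : E)‖ ≤ |s| + ‖x‖ := by
  refine (norm_add_le _ _).trans ?_
  rw [norm_smul, h.norm_eq, mul_one]
  rfl

theorem height_mem_ball (h : IsFlatAt D ρ y₀ ν ε r) {s : ℝ} (hs : |s| ≤ r / 2)
    {x : (ℝ ∙ ν)ᗮ} (hx : ‖x‖ < (1 - ε) * r / 4) : y₀ + (s • ν + (x : E)) ∈ Metric.ball y₀ r := by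
  rw [mem_ball_iff_norm, add_sub_cancel_left]
  refine (h.norm_height_le s x).trans_lt ?_
  nlinarith [mul_nonneg h.nonneg h.pos.le, h.pos]

/-- Near `y₀`, the set `D` is the region below a graph over the hyperplane orthogonal to `ν`. The
graph is found by the intermediate value theorem on each line parallel to `ν`, along which `ρ` is
strictly increasing. -/
theorem exists_graph (h : IsFlatAt D ρ y₀ ν ε r) (hD : IsOpen D) :
    ∃ g : (ℝ ∙ ν)ᗮ → ℝ, ∀ x : (ℝ ∙ ν)ᗮ, ‖x‖ < (1 - ε) * r / 4 → |g x| < r / 2 ∧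
      ∀ s : ℝ, |s| < r / 2 → ((y₀ + (s • ν + (x : E)) ∈ D ↔ s < g x) ∧
        (y₀ + (s • ν + (x : E)) ∈ frontier D ↔ s = g x)) := by
  have hr := h.pos
  have hε := h.nonneg
  have hε1 := h.lt_one
  have key : ∀ x : (ℝ ∙ ν)ᗮ, ‖x‖ < (1 - ε) * r / 4 → ∀ s t : ℝ, |s| ≤ r / 2 → |t| ≤ r / 2 →
      |ρ (y₀ + (s • ν + (x : E))) - ρ (y₀ + (t • ν + (x : E))) - (s - t)| ≤ ε * |s - t| := by
    intro x hx s t hs ht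
    have h1 := h.approx _ (h.height_mem_ball hs hx) _ (h.height_mem_ball ht hx)
    have e : y₀ + (s • ν + (x : E)) - (y₀ + (t • ν + (x : E))) = (s - t) • ν := by
      rw [sub_smul]; abel
    rwa [e, real_inner_smul_right, real_inner_self_eq_norm_sq, h.norm_eq, norm_smul, h.norm_eq,
      one_pow, mul_one, mul_one, Real.norm_eq_abs] at h1
  have base : ∀ x : (ℝ ∙ ν)ᗮ, ‖x‖ < (1 - ε) * r / 4 → ∀ s : ℝ, |s| ≤ r / 2 →
      |ρ (y₀ + (s • ν + (x : E))) - s| ≤ ε * (|s| + (1 - ε) * r / 4) := by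
    intro x hx s hs
    have h1 := h.approx _ (h.height_mem_ball hs hx) y₀ (Metric.mem_ball_self hr)
    rw [add_sub_cancel_left, h.inner_height, h.zero, sub_zero] at h1
    exact h1.trans (mul_le_mul_of_nonneg_left
      ((h.norm_height_le s x).trans (by linarith)) hε)
  have ex : ∀ x : (ℝ ∙ ν)ᗮ, ∃ t : ℝ, ‖x‖ < (1 - ε) * r / 4 →
      |t| < r / 2 ∧ ρ (y₀ + (t • ν + (x : E))) = 0 := by
    intro x
    by_cases hx : ‖x‖ < (1 - ε) * r / 4
    swap
    · exact ⟨0, fun h => absurd h hx⟩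
    have hcont : ContinuousOn (fun s : ℝ => ρ (y₀ + (s • ν + (x : E))))
        (Icc (-(r / 2)) (r / 2)) := by
      refine h.continuousOn.comp (by fun_prop) fun s hs => h.height_mem_ball (abs_le.2 hs) hx
    -- At the heights `±r / 2`, the deviation `ε (r / 2 + (1 - ε) r / 4)` of `ρ` from the height is
    -- less than `r / 2`.
    have b1 := base x hx (-(r / 2)) (by rw [abs_neg, abs_of_pos (by linarith)])
    have b2 := base x hx (r / 2) (by rw [abs_of_pos (by linarith)])
    rw [abs_neg] at b1
    rw [abs_of_pos (by linarith : 0 < r / 2)] at b1 b2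
    have hpos : 0 < r / 2 - ε * (r / 2 + (1 - ε) * r / 4) := by
      have : r / 2 - ε * (r / 2 + (1 - ε) * r / 4) = (1 - ε) * (2 - ε) * r / 4 := by ring
      rw [this]
      have := mul_pos (mul_pos (sub_pos.2 hε1) (by linarith : 0 < 2 - ε)) hr
      linarith
    have n1 : ρ (y₀ + ((-(r / 2)) • ν + (x : E))) < 0 := by linarith [(abs_le.1 b1).2]
    have n2 : 0 < ρ (y₀ + ((r / 2) • ν + (x : E))) := by linarith [(abs_le.1 b2).1]
    obtain ⟨t, ht, ht0⟩ := intermediate_value_Icc (by linarith) hcont ⟨n1.le, n2.le⟩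
    refine ⟨t, fun _ => ⟨abs_lt.2 ⟨lt_of_le_of_ne ht.1 ?_, lt_of_le_of_ne ht.2 ?_⟩, ht0⟩⟩
    · rintro rfl; exact n1.ne ht0
    · rintro rfl; exact n2.ne' ht0
  choose g hg using ex
  refine ⟨g, fun x hx => ⟨(hg x hx).1, fun s hs => ?_⟩⟩
  have hb := h.height_mem_ball hs.le hx
  have hk := key x hx s (g x) hs.le (hg x hx).1.le
  rw [(hg x hx).2, sub_zero, abs_le] at hk
  have sgn : (ρ (y₀ + (s • ν + (x : E))) < 0 ↔ s < g x) ∧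
      (ρ (y₀ + (s • ν + (x : E))) = 0 ↔ s = g x) := by
    rcases lt_trichotomy s (g x) with hlt | heq | hgt
    · rw [abs_of_neg (by linarith)] at hk
      have : ρ (y₀ + (s • ν + (x : E))) < 0 := by nlinarith [hk.2]
      exact ⟨by simp [this, hlt], by simp [this.ne, hlt.ne]⟩
    · rw [heq, (hg x hx).2]; simp
    · rw [abs_of_pos (by linarith)] at hk
      have : 0 < ρ (y₀ + (s • ν + (x : E))) := by nlinarith [hk.1]
      exact ⟨iff_of_false this.le.not_gt hgt.le.not_gt, iff_of_false this.ne' hgt.ne'⟩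
  exact ⟨(h.mem_iff _ hb).trans sgn.1, (h.mem_frontier_iff hD hb).trans sgn.2⟩

variable (y₀ ν ε r) in
/-- The open cylinder with axis `ν` about `y₀` in which `D` is the region below a graph. -/
def cylinder : Set E :=
  {y | |⟪ν, y - y₀⟫| < r / 2 ∧ ‖(ℝ ∙ ν)ᗮ.orthogonalProjectionOnto (y - y₀)‖ < (1 - ε) * r / 4}

theorem isOpen_cylinder : IsOpen (cylinder y₀ ν ε r) :=
  (isOpen_lt (f := fun y => |⟪ν, y - y₀⟫|) (by fun_prop) continuous_const).inter
    (isOpen_lt (f := fun y => ‖(ℝ ∙ ν)ᗮ.orthogonalProjectionOnto (y - y₀)‖) (by fun_prop)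
      continuous_const)

theorem mem_cylinder_self (h : IsFlatAt D ρ y₀ ν ε r) : y₀ ∈ cylinder y₀ ν ε r := by
  have := mul_pos (sub_pos.2 h.lt_one) h.pos
  constructor
  · simpa using h.pos
  · rw [sub_self, map_zero, norm_zero]; linarith

theorem projection_height (s : ℝ) (x : (ℝ ∙ ν)ᗮ) :
    (ℝ ∙ ν)ᗮ.orthogonalProjectionOnto (s • ν + (x : E)) = x := by
  rw [map_add, Submodule.orthogonalProjectionOnto_mem_subspace_eq_self, map_smul,
    Submodule.orthogonalProjectionOnto_orthogonal_apply_eq_zero, smul_zero, zero_add]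
  exact Submodule.mem_span_singleton_self ν

theorem height_mem_cylinder_iff (h : IsFlatAt D ρ y₀ ν ε r) (s : ℝ) (x : (ℝ ∙ ν)ᗮ) :
    y₀ + (s • ν + (x : E)) ∈ cylinder y₀ ν ε r ↔ |s| < r / 2 ∧ ‖x‖ < (1 - ε) * r / 4 := by
  rw [cylinder, mem_ofPred_eq, add_sub_cancel_left, h.inner_height, projection_height]

theorem cylinder_subset_ball [FiniteDimensional ℝ E] [MeasurableSpace E] [BorelSpace E]
    (h : IsFlatAt D ρ y₀ ν ε r) : cylinder y₀ ν ε r ⊆ Metric.ball y₀ r := by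
  intro y hy
  obtain ⟨q, rfl⟩ := (heightCoord h.norm_eq y₀).surjective y
  rw [heightCoord_apply] at hy ⊢
  have hy' := (h.height_mem_cylinder_iff _ _).1 hy
  exact h.height_mem_ball hy'.1.le hy'.2

end IsFlatAt

end Graph

/-! ### Surface measure on a nearly flat boundary -/

section GraphMeasure

open Filter Topology Set
open scoped RealInnerProductSpace NNReal ENNReal

theorem _root_.LipschitzOnWith.euclideanHausdorffMeasure_image_le {X Y : Type*} [EMetricSpace X]
    [MeasurableSpace X] [BorelSpace X] [EMetricSpace Y] [MeasurableSpace Y] [BorelSpace Y]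
    {K : ℝ≥0} {f : X → Y} {s : Set X} (h : LipschitzOnWith K f s) (d : ℕ) :
    μHE[d] (f '' s) ≤ (K : ℝ≥0∞) ^ d * μHE[d] s := by
  simp_rw [Measure.euclideanHausdorffMeasure_def, Measure.smul_apply, ENNReal.smul_def, smul_eq_mul]
  have := h.hausdorffMeasure_image_le (d := d) (by positivity)
  rw [ENNReal.rpow_natCast] at this
  rw [mul_left_comm]
  gcongr

variable {E : Type*} [NormedAddCommGroup E] [InnerProductSpace ℝ E] [FiniteDimensional ℝ E]
  [MeasurableSpace E] [BorelSpace E] {D : Set E} {ρ : E → ℝ} {y₀ ν : E} {ε r : ℝ}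

namespace IsFlatAt

/-- On the cylinder about `y₀`, the boundary of `D` is the graph of a function over a ball in the
hyperplane orthogonal to `ν`, the parametrization `G` is Lipschitz with constant `(1 - ε)⁻¹` and its
inverse, an orthogonal projection, is Lipschitz with constant `1`. Therefore the image under `G` of
the Lebesgue measure approximates the surface measure. -/
theorem exists_graph_measure (h : IsFlatAt D ρ y₀ ν ε r) (hD : IsOpen D) {d : ℕ}
    (hd : Module.finrank ℝ E = d + 1) :
    ∃ g : (ℝ ∙ ν)ᗮ → ℝ,
      (∀ x : (ℝ ∙ ν)ᗮ, ‖x‖ < (1 - ε) * r / 4 → ∀ s : ℝ, |s| < r / 2 →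
        (y₀ + (s • ν + (x : E)) ∈ D ↔ s < g x)) ∧
      ContinuousOn (fun x => y₀ + (g x • ν + (x : E))) (Metric.ball 0 ((1 - ε) * r / 4)) ∧
      (volume.restrict (Metric.ball 0 ((1 - ε) * r / 4))).map
          (fun x => y₀ + (g x • ν + (x : E))) ≤
        (μHE[d]).restrict (frontier D ∩ cylinder y₀ ν ε r) ∧
      (μHE[d]).restrict (frontier D ∩ cylinder y₀ ν ε r) ≤
        ((Real.toNNReal (1 - ε)⁻¹) ^ d) •
          (volume.restrict (Metric.ball 0 ((1 - ε) * r / 4))).map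
            (fun x => y₀ + (g x • ν + (x : E))) := by
  obtain ⟨g, hg⟩ := h.exists_graph hD
  set B : Set (ℝ ∙ ν)ᗮ := Metric.ball 0 ((1 - ε) * r / 4) with hB
  set G : (ℝ ∙ ν)ᗮ → E := fun x => y₀ + (g x • ν + (x : E)) with hG
  set P : E → (ℝ ∙ ν)ᗮ := fun y => (ℝ ∙ ν)ᗮ.orthogonalProjectionOnto (y - y₀) with hP
  have hε1 := sub_pos.2 h.lt_one
  have mB : ∀ x, x ∈ B ↔ ‖x‖ < (1 - ε) * r / 4 := fun x => by simp [hB]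
  have hPh : ∀ (s : ℝ) (x : (ℝ ∙ ν)ᗮ), P (y₀ + (s • ν + (x : E))) = x := fun s x => by
    rw [hP]
    dsimp only
    rw [add_sub_cancel_left, projection_height]
  have hGS : ∀ x ∈ B, G x ∈ frontier D ∩ cylinder y₀ ν ε r := fun x hx => by
    have hx' := (mB x).1 hx
    have h1 := hg x hx'
    exact ⟨((h1.2 (g x) h1.1).2).2 rfl, (h.height_mem_cylinder_iff _ _).2 ⟨h1.1, hx'⟩⟩
  have hSG : ∀ y ∈ frontier D ∩ cylinder y₀ ν ε r, P y ∈ B ∧ G (P y) = y := fun y hy => by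
    obtain ⟨⟨s, x⟩, rfl⟩ := (heightCoord h.norm_eq y₀).surjective y
    rw [heightCoord_apply] at hy ⊢
    dsimp only at hy ⊢
    have hc := (h.height_mem_cylinder_iff _ _).1 hy.2
    have hs := (((hg x hc.2).2 s hc.1).2).1 hy.1
    rw [hPh, mB]
    exact ⟨hc.2, by rw [hG, hs]⟩
  have hPl : LipschitzWith 1 P := by
    refine LipschitzWith.of_dist_le_mul fun y z => ?_
    rw [hP, dist_eq_norm, ← map_sub, sub_sub_sub_cancel_right, dist_eq_norm, NNReal.coe_one,
      one_mul]
    exact Submodule.norm_orthogonalProjectionOnto_apply_le _ _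
  have hGl : LipschitzOnWith (Real.toNNReal (1 - ε)⁻¹) G B := by
    refine LipschitzOnWith.of_dist_le_mul fun x hx z hz => ?_
    rw [Real.coe_toNNReal _ (inv_nonneg.2 hε1.le), dist_eq_norm, dist_eq_norm, inv_mul_eq_div,
      le_div_iff₀ hε1]
    have bx := h.cylinder_subset_ball (hGS x hx).2
    have bz := h.cylinder_subset_ball (hGS z hz).2
    have h1 := h.approx _ bx _ bz
    rw [(h.mem_frontier_iff hD bx).1 (hGS x hx).1, (h.mem_frontier_iff hD bz).1 (hGS z hz).1,
      sub_zero, zero_sub, abs_neg] at h1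
    have e : G x - G z = (g x - g z) • ν + ((x - z : (ℝ ∙ ν)ᗮ) : E) := by
      rw [hG, sub_smul, Submodule.coe_sub]; dsimp only; abel
    have h2 := h.norm_height_le (g x - g z) (x - z)
    have h3 := h.inner_height (g x - g z) (x - z)
    rw [← e] at h2 h3
    rw [h3] at h1
    linarith
  have hmeas : AEMeasurable G (volume.restrict B) :=
    hGl.continuousOn.aemeasurable Metric.isOpen_ball.measurableSet
  have hfin : Module.finrank ℝ (ℝ ∙ ν)ᗮ = d := by
    have : Fact (Module.finrank ℝ E = d + 1) := ⟨hd⟩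
    exact Submodule.finrank_orthogonal_span_singleton (norm_ne_zero_iff.1 (by simp [h.norm_eq]))
  have hvol : (volume : Measure (ℝ ∙ ν)ᗮ) = μHE[d] := by
    rw [← hfin, InnerProductSpace.euclideanHausdorffMeasure_eq_volume]
  have e1 : ∀ s : Set E, P '' (s ∩ (frontier D ∩ cylinder y₀ ν ε r)) = G ⁻¹' s ∩ B := by
    intro s
    ext x
    constructor
    · rintro ⟨y, ⟨hys, hy⟩, rfl⟩
      obtain ⟨h1, h2⟩ := hSG y hy
      exact ⟨by rwa [mem_preimage, h2], h1⟩
    · rintro ⟨hxs, hx⟩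
      exact ⟨G x, ⟨hxs, hGS x hx⟩, hPh _ _⟩
  have e2 : ∀ s : Set E, G '' (G ⁻¹' s ∩ B) = s ∩ (frontier D ∩ cylinder y₀ ν ε r) := by
    intro s
    ext y
    constructor
    · rintro ⟨x, ⟨hxs, hx⟩, rfl⟩
      exact ⟨hxs, hGS x hx⟩
    · rintro ⟨hys, hy⟩
      obtain ⟨h1, h2⟩ := hSG y hy
      exact ⟨P y, ⟨by rwa [mem_preimage, h2], h1⟩, h2⟩
  have hBm : MeasurableSet B := Metric.isOpen_ball.measurableSet
  refine ⟨g, fun x hx s hs => ((hg x hx).2 s hs).1, hGl.continuousOn, ?_, ?_⟩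
  · refine Measure.le_iff.2 fun s hs => ?_
    rw [Measure.map_apply_of_aemeasurable hmeas hs, Measure.restrict_apply' hBm,
      Measure.restrict_apply hs, hvol, ← e1]
    simpa using (hPl.lipschitzOnWith
      (s := s ∩ (frontier D ∩ cylinder y₀ ν ε r))).euclideanHausdorffMeasure_image_le d
  · refine Measure.le_iff.2 fun s hs => ?_
    rw [Measure.smul_apply, Measure.map_apply_of_aemeasurable hmeas hs,
      Measure.restrict_apply' hBm, Measure.restrict_apply hs, hvol, ← e2, ENNReal.smul_def,
      smul_eq_mul, ENNReal.coe_pow]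
    exact (hGl.mono inter_subset_right).euclideanHausdorffMeasure_image_le d

/-- The fundamental theorem of calculus on the lines parallel to `ν`. -/
theorem integral_fderiv_eq (h : IsFlatAt D ρ y₀ ν ε r) (hD : IsOpen D) {g : (ℝ ∙ ν)ᗮ → ℝ}
    (hg : ∀ x : (ℝ ∙ ν)ᗮ, ‖x‖ < (1 - ε) * r / 4 → ∀ s : ℝ, |s| < r / 2 →
      (y₀ + (s • ν + (x : E)) ∈ D ↔ s < g x))
    {u : E → ℝ} (hu : ContDiff ℝ 1 u) (hc : HasCompactSupport u)
    (hV : tsupport u ⊆ cylinder y₀ ν ε r) :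
    ∫ y in D, fderiv ℝ u y ν =
      ∫ x in Metric.ball 0 ((1 - ε) * r / 4), u (y₀ + (g x • ν + ((x : (ℝ ∙ ν)ᗮ) : E))) := by
  have hi : Integrable (D.indicator fun y => fderiv ℝ u y ν) :=
    (integrable_fderiv_apply hu hc ν).indicator hD.measurableSet
  have hmp := measurePreserving_heightCoord h.norm_eq y₀
  rw [← integral_indicator hD.measurableSet, ← hmp.integral_comp',
    ← integral_indicator Metric.isOpen_ball.measurableSet]
  have hi2 : Integrable
      (fun q => D.indicator (fun y => fderiv ℝ u y ν) (heightCoord h.norm_eq y₀ q))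
      ((volume : Measure ℝ).prod (volume : Measure (ℝ ∙ ν)ᗮ)) :=
    (hmp.integrable_comp_emb (MeasurableEquiv.measurableEmbedding _)).2 hi
  rw [Measure.volume_eq_prod, integral_prod_symm _ hi2]
  refine integral_congr_ae (Eventually.of_forall fun x => ?_)
  dsimp only
  -- Lines that miss the cylinder do not meet the support of `u`.
  have z0 : ∀ s : ℝ, ¬ (|s| < r / 2 ∧ ‖x‖ < (1 - ε) * r / 4) →
      y₀ + (s • ν + (x : E)) ∉ tsupport u := fun s hs hmem =>
    hs ((h.height_mem_cylinder_iff s x).1 (hV hmem))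
  have z1 : ∀ y, y ∉ tsupport u → fderiv ℝ u y ν = 0 := fun y hy => by
    rw [fderiv_of_notMem_tsupport (𝕜 := ℝ) hy]; rfl
  by_cases hx : ‖x‖ < (1 - ε) * r / 4
  · rw [indicator_of_mem (by simpa using hx)]
    set f : ℝ → ℝ := fun s => u (y₀ + (s • ν + (x : E))) with hf
    have hfd : ContDiff ℝ 1 f := hu.comp (by fun_prop)
    have hfc : HasCompactSupport f := by
      refine HasCompactSupport.intro (isCompact_Icc (a := -(r / 2)) (b := r / 2)) fun s hs => ?_
      exact image_eq_zero_of_notMem_tsupport (f := u)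
        (z0 s fun hh => hs (abs_le.1 hh.1.le))
    change _ = f (g x)
    rw [← hfc.integral_Iic_deriv_eq hfd, integral_Iic_eq_integral_Iio,
      ← integral_indicator measurableSet_Iio]
    refine integral_congr_ae (Eventually.of_forall fun s => ?_)
    dsimp only
    rw [heightCoord_apply]
    have hder : deriv f s = fderiv ℝ u (y₀ + (s • ν + (x : E))) ν := by
      have h2 : HasDerivAt (fun s : ℝ => y₀ + (s • ν + (x : E))) ν s := by
        simpa using (((hasDerivAt_id s).smul_const ν).add_const (x : E)).const_add y₀
      exact ((hu.differentiable (by simp) _).hasFDerivAt.comp_hasDerivAt s h2).deriv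
    by_cases hs : |s| < r / 2
    · by_cases hsD : s < g x
      · rw [indicator_of_mem ((hg x hx s hs).2 hsD), indicator_of_mem (mem_Iio.2 hsD), hder]
      · rw [indicator_of_notMem (fun hh => hsD ((hg x hx s hs).1 hh)),
          indicator_of_notMem (s := Iio (g x)) hsD]
    · have := z1 _ (z0 s fun hh => hs hh.1)
      have i1 : D.indicator (fun y => fderiv ℝ u y ν) (y₀ + (s • ν + (x : E))) = 0 :=
        indicator_apply_eq_zero.2 fun _ => this
      have i2 : (Iio (g x)).indicator (deriv f) s = 0 :=
        indicator_apply_eq_zero.2 fun _ => hder.trans this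
      exact i1.trans i2.symm
  · rw [indicator_of_notMem (by simpa using hx)]
    refine integral_eq_zero_of_ae (Eventually.of_forall fun s => ?_)
    dsimp only
    rw [heightCoord_apply]
    refine indicator_apply_eq_zero.2 fun _ => z1 _ (z0 s fun hh => hx hh.2)

theorem measure_frontier_inter_cylinder_lt_top (h : IsFlatAt D ρ y₀ ν ε r) (hD : IsOpen D)
    {d : ℕ} (hd : Module.finrank ℝ E = d + 1) :
    μHE[d] (frontier D ∩ cylinder y₀ ν ε r) < ⊤ := by
  obtain ⟨g, -, hG, -, h2⟩ := h.exists_graph_measure hD hd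
  have := Measure.le_iff.1 h2 univ MeasurableSet.univ
  rw [Measure.restrict_apply MeasurableSet.univ, univ_inter, Measure.smul_apply,
    Measure.map_apply_of_aemeasurable
      (hG.aemeasurable Metric.isOpen_ball.measurableSet) MeasurableSet.univ] at this
  refine this.trans_lt ?_
  rw [ENNReal.smul_def, smul_eq_mul]
  refine ENNReal.mul_lt_top ENNReal.coe_lt_top ?_
  simpa using measure_ball_lt_top

/-- For functions supported near `y₀`, integrating the derivative in the direction `ν` over `D` is
nearly the same as integrating over the boundary. -/
theorem integral_fderiv_normal (h : IsFlatAt D ρ y₀ ν ε r) (hD : IsOpen D)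
    {d : ℕ} (hd : Module.finrank ℝ E = d + 1)
    {u : E → ℝ} (hu : ContDiff ℝ 1 u) (hc : HasCompactSupport u) (h0 : ∀ y, 0 ≤ u y)
    (hV : tsupport u ⊆ cylinder y₀ ν ε r) :
    ∫ y in D, fderiv ℝ u y ν ≤ ∫ y in frontier D, u y ∂μHE[d] ∧
    (1 - ε) ^ d * ∫ y in frontier D, u y ∂μHE[d] ≤ ∫ y in D, fderiv ℝ u y ν := by
  obtain ⟨g, hg, hG, h1, h2⟩ := h.exists_graph_measure hD hd
  have hmeas := hG.aemeasurable (μ := volume) Metric.isOpen_ball.measurableSet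
  have hε1 := sub_pos.2 h.lt_one
  have hS : ∫ y in frontier D, u y ∂μHE[d] =
      ∫ y in frontier D ∩ cylinder y₀ ν ε r, u y ∂μHE[d] := by
    refine setIntegral_eq_of_subset_of_forall_sdiff_eq_zero isClosed_frontier.measurableSet
      inter_subset_left fun y hy => ?_
    exact image_eq_zero_of_notMem_tsupport fun hh => hy.2 ⟨hy.1, hV hh⟩
  have hL : ∫ y in D, fderiv ℝ u y ν = ∫ y, u y ∂((volume.restrict
      (Metric.ball 0 ((1 - ε) * r / 4))).map (fun x => y₀ + (g x • ν + (x : E)))) := by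
    rw [h.integral_fderiv_eq hD hg hu hc hV,
      integral_map hmeas hu.continuous.aestronglyMeasurable]
  have hint : ∀ m : Measure E, IsFiniteMeasure m → Integrable u m := fun m hm =>
    hu.continuous.integrable_of_hasCompactSupport hc
  have hfin : IsFiniteMeasure ((μHE[d]).restrict (frontier D ∩ cylinder y₀ ν ε r)) :=
    ⟨by simpa using h.measure_frontier_inter_cylinder_lt_top hD hd⟩
  have hfin2 := isFiniteMeasure_of_le _ h1
  rw [hS, hL]
  refine ⟨integral_mono_measure h1 (Eventually.of_forall h0) (hint _ hfin), ?_⟩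
  have := integral_mono_measure h2 (Eventually.of_forall h0) (hint _ inferInstance)
  rw [integral_smul_nnreal_measure, NNReal.smul_def, smul_eq_mul, NNReal.coe_pow,
    Real.coe_toNNReal _ (inv_nonneg.2 hε1.le), inv_pow] at this
  rwa [← le_inv_mul_iff₀ (pow_pos hε1 d)]

end IsFlatAt

end GraphMeasure

/-! ### The Gauss–Green formula -/

section GaussGreen

open Filter Topology Set
open scoped RealInnerProductSpace NNReal ENNReal Manifold

variable {E : Type*} [NormedAddCommGroup E] [InnerProductSpace ℝ E]

/-- A bounded open set whose boundary is, near each of its points, arbitrarily flat in the sense of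
`IsFlatAt`, with unit normal `N` depending continuously on the point: a bounded domain of class
`C¹` with outward unit normal `N`. -/
structure IsFlatDomain (D : Set E) (N : E → E) : Prop where
  isOpen : IsOpen D
  isBounded : Bornology.IsBounded D
  continuousOn : ContinuousOn N (frontier D)
  exists_flat : ∀ y ∈ frontier D, ∀ ε : ℝ, 0 < ε → ε < 1 → ∃ ρ r, IsFlatAt D ρ y (N y) ε r

variable [FiniteDimensional ℝ E] {D : Set E} {N : E → E}

theorem exists_contDiff_partition {K : Set E} (hK : IsCompact K) {U : E → Set E}
    (hU : ∀ x, IsOpen (U x)) (hxU : ∀ x, x ∈ U x) :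
    ∃ (s : Finset E) (χ : E → E → ℝ), (∀ i, ContDiff ℝ ∞ (χ i)) ∧ (∀ i x, 0 ≤ χ i x) ∧
      (∀ i, tsupport (χ i) ⊆ U i) ∧ ∀ x ∈ K, ∑ i ∈ s, χ i x = 1 := by
  obtain ⟨f, hf⟩ := SmoothPartitionOfUnity.exists_isSubordinate 𝓘(ℝ, E) (isClosed_univ (X := E)) U
    hU fun x _ => mem_iUnion.2 ⟨x, hxU x⟩
  have hfin := f.locallyFinite.finite_nonempty_inter_compact hK
  refine ⟨hfin.toFinset, fun i => f i, fun i => (f i).contMDiff.contDiff, fun i x => f.nonneg i x,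
    hf, fun x hx => ?_⟩
  rw [← f.sum_eq_one (mem_univ x)]
  refine (finsum_eq_sum_of_support_subset _ fun i hi => ?_).symm
  rw [Finite.coe_toFinset]
  exact ⟨x, hi, hx⟩

omit [FiniteDimensional ℝ E] in
theorem eventually_sub_smul_mem {V K : Set E} (hV : IsOpen V) (hK : IsCompact K) (hKV : K ⊆ V)
    (w : E) : ∀ᶠ t : ℝ in 𝓝 0, ∀ y ∈ K, y - t • w ∈ V := by
  obtain ⟨η, hη, hsub⟩ := hK.exists_thickening_subset_open hV hKV
  have : Tendsto (fun t : ℝ => ‖t • w‖) (𝓝 0) (𝓝 0) := by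
    have : ContinuousAt (fun t : ℝ => ‖t • w‖) 0 := by fun_prop
    simpa [ContinuousAt] using this
  filter_upwards [this.eventually (gt_mem_nhds hη)] with t ht y hy
  refine hsub (Metric.mem_thickening_iff.2 ⟨y, hy, ?_⟩)
  rw [dist_eq_norm, sub_sub_cancel_left, norm_neg]
  exact ht

namespace IsFlatAt

omit [FiniteDimensional ℝ E] in
theorem sub_mem {ρ : E → ℝ} {y₀ ν : E} {ε r : ℝ}
    (h : IsFlatAt D ρ y₀ ν ε r) {y w : E} (hy : y ∈ D) (hyb : y ∈ Metric.ball y₀ r)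
    (hyw : y - w ∈ Metric.ball y₀ r) (hw : ε * ‖w‖ ≤ ⟪ν, w⟫) : y - w ∈ D :=
  (h.mem_iff _ hyw).2 ((h.le_of_cone hyb hyw hw).trans_lt ((h.mem_iff _ hyb).1 hy))

theorem integral_fderiv_nonneg [MeasurableSpace E] [BorelSpace E] {ρ : E → ℝ} {y₀ ν : E} {ε r : ℝ}
    (h : IsFlatAt D ρ y₀ ν ε r) (hD : IsOpen D) (hDb : volume D ≠ ⊤)
    {u : E → ℝ} (hu : ContDiff ℝ 1 u) (hc : HasCompactSupport u) (h0 : ∀ y, 0 ≤ u y)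
    (hV : tsupport u ⊆ Metric.ball y₀ r) {w : E} (hw : ε * ‖w‖ ≤ ⟪ν, w⟫) :
    0 ≤ ∫ y in D, fderiv ℝ u y w := by
  refine integral_fderiv_nonneg_of_shift hD.measurableSet hDb hu hc h0 ?_
  filter_upwards [nhdsWithin_le_nhds (eventually_sub_smul_mem Metric.isOpen_ball hc.isCompact hV w),
    self_mem_nhdsWithin] with t ht ht0 y hy huy
  have ht0' : (0 : ℝ) < t := ht0
  have hyu : y ∈ tsupport u := subset_tsupport u huy
  refine h.sub_mem hy (hV hyu) (ht y hyu) ?_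
  rw [norm_smul, Real.norm_eq_abs, abs_of_pos ht0', real_inner_smul_right]
  nlinarith

end IsFlatAt

namespace IsFlatDomain

variable [MeasurableSpace E] [BorelSpace E]

omit [MeasurableSpace E] [BorelSpace E] in
theorem isCompact_frontier (h : IsFlatDomain D N) : IsCompact (frontier D) :=
  h.isBounded.isCompact_closure.of_isClosed_subset isClosed_frontier frontier_subset_closure

theorem volume_ne_top (h : IsFlatDomain D N) : volume D ≠ ⊤ := h.isBounded.measure_lt_top.ne

theorem measure_frontier_ne_top (h : IsFlatDomain D N) {d : ℕ}
    (hd : Module.finrank ℝ E = d + 1) : μHE[d] (frontier D) ≠ ⊤ := by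
  refine (h.isCompact_frontier.measure_lt_top_of_nhdsWithin fun y hy => ?_).ne
  obtain ⟨ρ, r, hρ⟩ := h.exists_flat y hy (1 / 2) (by norm_num) (by norm_num)
  exact ⟨_, inter_mem self_mem_nhdsWithin (mem_nhdsWithin_of_mem_nhds
    (IsFlatAt.isOpen_cylinder.mem_nhds hρ.mem_cylinder_self)),
    hρ.measure_frontier_inter_cylinder_lt_top h.isOpen hd⟩

theorem integrableOn_frontier (h : IsFlatDomain D N) {d : ℕ}
    (hd : Module.finrank ℝ E = d + 1) {F : Type*} [NormedAddCommGroup F] {f : E → F}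
    (hf : ContinuousOn f (frontier D)) : IntegrableOn f (frontier D) μHE[d] :=
  hf.integrableOn_of_subset_isCompact h.isCompact_frontier isClosed_frontier.measurableSet
    Subset.rfl (h.measure_frontier_ne_top hd)

theorem integrableOn_inner (h : IsFlatDomain D N) {d : ℕ}
    (hd : Module.finrank ℝ E = d + 1) {u : E → ℝ} (hu : Continuous u) (v : E) :
    IntegrableOn (fun y => u y * ⟪N y, v⟫) (frontier D) μHE[d] :=
  h.integrableOn_frontier hd (hu.continuousOn.mul (h.continuousOn.inner continuousOn_const))

/-- For `u ≥ 0` supported near a boundary point `y₀`, the derivative of `u` in any direction has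
nearly the integral over `D` that the Gauss–Green formula predicts. In the direction of the normal
at `y₀` this is the fundamental theorem of calculus; the integral of a derivative in a tangential
direction `±w` is small, since it becomes nonnegative on adding a small multiple of the normal
to `±w`. -/
theorem exists_nhds_frontier_estimate (h : IsFlatDomain D N) {d : ℕ}
    (hd : Module.finrank ℝ E = d + 1) {y₀ : E} (hy₀ : y₀ ∈ frontier D) {ε : ℝ} (hε : 0 < ε)
    (hε2 : ε ≤ 1 / 2) :
    ∃ V, IsOpen V ∧ y₀ ∈ V ∧ ∀ u : E → ℝ, ContDiff ℝ 1 u → HasCompactSupport u → (∀ y, 0 ≤ u y) →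
      tsupport u ⊆ V → ∀ v : E,
        |(∫ y in D, fderiv ℝ u y v) - ∫ y in frontier D, u y * ⟪N y, v⟫ ∂μHE[d]| ≤
          (d + 3) * ε * ‖v‖ * ∫ y in frontier D, u y ∂μHE[d] := by
  obtain ⟨ρ, r, hρ⟩ := h.exists_flat y₀ hy₀ ε hε (by linarith)
  obtain ⟨O, hO, hyO, hON⟩ : ∃ O, IsOpen O ∧ y₀ ∈ O ∧ ∀ y ∈ O ∩ frontier D, ‖N y - N y₀‖ < ε := by
    have := (h.continuousOn y₀ hy₀).eventually (Metric.ball_mem_nhds (N y₀) hε)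
    obtain ⟨O, hO, hyO, hs⟩ := mem_nhdsWithin.1 this
    exact ⟨O, hO, hyO, fun y hy => mem_ball_iff_norm.1 (hs hy)⟩
  refine ⟨IsFlatAt.cylinder y₀ (N y₀) ε r ∩ O, IsFlatAt.isOpen_cylinder.inter hO,
    ⟨hρ.mem_cylinder_self, hyO⟩, fun u hu hc h0 hV v => ?_⟩
  have hVc := hV.trans inter_subset_left
  have hVb := hVc.trans hρ.cylinder_subset_ball
  set ν := N y₀ with hν
  have hνn : ‖ν‖ = 1 := hρ.norm_eq
  set I := ∫ y in frontier D, u y ∂μHE[d] with hI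
  set Λ : E → ℝ := fun v => ∫ y in D, fderiv ℝ u y v with hΛ
  have hI0 : 0 ≤ I := integral_nonneg h0
  have hadd : ∀ a b : E, Λ (a + b) = Λ a + Λ b := fun a b => by
    rw [hΛ]
    dsimp only
    rw [← integral_add (integrable_fderiv_apply hu hc a).integrableOn
      (integrable_fderiv_apply hu hc b).integrableOn]
    simp
  have hsmul : ∀ (c : ℝ) (a : E), Λ (c • a) = c * Λ a := fun c a => by
    rw [hΛ]
    dsimp only
    rw [← integral_const_mul]
    simp
  obtain ⟨hn1, hn2⟩ := hρ.integral_fderiv_normal h.isOpen hd hu hc h0 hVc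
  change Λ ν ≤ I at hn1
  change (1 - ε) ^ d * I ≤ Λ ν at hn2
  set c := ⟪ν, v⟫ with hc'
  have hcv : |c| ≤ ‖v‖ := by simpa [hνn] using abs_real_inner_le_norm ν v
  have hΛ0 : 0 ≤ Λ ν := (mul_nonneg (pow_nonneg (by linarith) d) hI0).trans hn2
  have horth : ⟪ν, v - c • ν⟫ = 0 := by
    rw [inner_sub_right, real_inner_smul_right, real_inner_self_eq_norm_sq, hνn, ← hc']; ring
  have htan : ‖v - c • ν‖ ≤ ‖v‖ := by
    have : ‖v‖ ^ 2 = ‖c • ν‖ ^ 2 + ‖v - c • ν‖ ^ 2 := by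
      have := norm_add_sq_real (c • ν) (v - c • ν)
      rw [add_sub_cancel, real_inner_smul_left, horth] at this
      linarith
    exact le_of_sq_le_sq (by nlinarith [sq_nonneg ‖c • ν‖]) (norm_nonneg v)
  have hcone : ∀ w : E, ⟪ν, w⟫ = 0 → ‖w‖ ≤ ‖v‖ → 0 ≤ Λ w + 2 * ε * ‖v‖ * Λ ν := by
    intro w hw hwv
    rw [← hsmul, ← hadd]
    refine hρ.integral_fderiv_nonneg h.isOpen h.volume_ne_top hu hc h0 hVb ?_
    rw [inner_add_right, hw, real_inner_smul_right, real_inner_self_eq_norm_sq, hνn]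
    have := norm_add_le w ((2 * ε * ‖v‖) • ν)
    rw [norm_smul, hνn, Real.norm_eq_abs, abs_of_nonneg (by positivity)] at this
    nlinarith [norm_nonneg v, mul_nonneg hε.le (norm_nonneg v)]
  -- The bound `d + 3` is made up of `2` for the tangential part of `v`, of `d` for the comparison
  -- of the measures, and of `1` for the variation of the normal.
  have t1 : |Λ (v - c • ν)| ≤ 2 * ε * ‖v‖ * I := by
    have c1 := hcone _ horth htan
    have c2 := hcone (-(v - c • ν)) (by rw [inner_neg_right, horth, neg_zero])
      (by rwa [norm_neg])
    rw [← neg_one_smul ℝ (v - c • ν), hsmul] at c2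
    have : 2 * ε * ‖v‖ * Λ ν ≤ 2 * ε * ‖v‖ * I := by gcongr
    exact abs_le.2 ⟨by linarith, by linarith⟩
  have t2 : |c * (Λ ν - I)| ≤ ‖v‖ * (d * ε * I) := by
    rw [abs_mul]
    refine mul_le_mul hcv ?_ (abs_nonneg _) (norm_nonneg _)
    have hb := one_add_mul_le_pow (a := -ε) (by linarith) d
    rw [abs_sub_comm, abs_of_nonneg (by linarith)]
    have := mul_le_mul_of_nonneg_right hb hI0
    rw [← sub_eq_add_neg 1 ε] at this
    linarith
  have hiu : IntegrableOn u (frontier D) μHE[d] :=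
    h.integrableOn_frontier hd hu.continuous.continuousOn
  have t3 : |c * I - ∫ y in frontier D, u y * ⟪N y, v⟫ ∂μHE[d]| ≤ ε * ‖v‖ * I := by
    rw [hI, ← integral_const_mul, ← integral_const_mul,
      ← integral_sub (hiu.const_mul c) (h.integrableOn_inner hd hu.continuous v),
      ← Real.norm_eq_abs]
    refine norm_integral_le_of_norm_le (hiu.const_mul _) ?_
    refine (ae_restrict_iff' isClosed_frontier.measurableSet).2
      (Eventually.of_forall fun y hy => ?_)
    have e : c * u y - u y * ⟪N y, v⟫ = u y * ⟪ν - N y, v⟫ := by rw [inner_sub_left, ← hc']; ring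
    rw [e, norm_mul, Real.norm_eq_abs, abs_of_nonneg (h0 y), mul_comm]
    by_cases hyu : u y = 0
    · simp [hyu]
    · have hyV := hV (subset_tsupport u hyu)
      refine mul_le_mul_of_nonneg_right ?_ (h0 y)
      refine (norm_inner_le_norm _ _).trans ?_
      rw [norm_sub_rev]
      exact mul_le_mul_of_nonneg_right (hON y ⟨hyV.2, hy⟩).le (norm_nonneg v)
  have hsplit : Λ v = Λ (v - c • ν) + c * Λ ν := by rw [← hsmul, ← hadd, sub_add_cancel]
  have : Λ v - ∫ y in frontier D, u y * ⟪N y, v⟫ ∂μHE[d] = Λ (v - c • ν) + c * (Λ ν - I) +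
      (c * I - ∫ y in frontier D, u y * ⟪N y, v⟫ ∂μHE[d]) := by rw [hsplit]; ring
  change |Λ v - _| ≤ _
  rw [this]
  refine (abs_add_three _ _ _).trans ?_
  linarith

/-- The estimate near a boundary point extends trivially to all points. -/
theorem exists_nhds_estimate (h : IsFlatDomain D N) {d : ℕ}
    (hd : Module.finrank ℝ E = d + 1) (y₀ : E) {ε : ℝ} (hε : 0 < ε) (hε2 : ε ≤ 1 / 2) :
    ∃ V, IsOpen V ∧ y₀ ∈ V ∧ ∀ u : E → ℝ, ContDiff ℝ 1 u → HasCompactSupport u → (∀ y, 0 ≤ u y) →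
      tsupport u ⊆ V → ∀ v : E,
        |(∫ y in D, fderiv ℝ u y v) - ∫ y in frontier D, u y * ⟪N y, v⟫ ∂μHE[d]| ≤
          (d + 3) * ε * ‖v‖ * ∫ y in frontier D, u y ∂μHE[d] := by
  by_cases hy₀ : y₀ ∈ frontier D
  · exact h.exists_nhds_frontier_estimate hd hy₀ hε hε2
  -- Away from the boundary, the indicator function of `D` is locally constant, so that the integral
  -- of a derivative is nonnegative in all directions.
  refine ⟨(frontier D)ᶜ, isClosed_frontier.isOpen_compl, hy₀, fun u hu hc h0 hV v => ?_⟩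
  have hnn : ∀ w : E, 0 ≤ ∫ y in D, fderiv ℝ u y w := fun w => by
    refine integral_fderiv_nonneg_of_shift h.isOpen.measurableSet h.volume_ne_top hu hc h0 ?_
    have hK : IsCompact (closure D ∩ tsupport u) := hc.isCompact.inter_left isClosed_closure
    have hKD : closure D ∩ tsupport u ⊆ D := fun y hy => by
      by_contra hyD
      exact hV hy.2 (by rw [h.isOpen.frontier_eq]; exact ⟨hy.1, hyD⟩)
    filter_upwards [nhdsWithin_le_nhds (eventually_sub_smul_mem h.isOpen hK hKD w)]
      with t ht y hy huy
    exact ht y ⟨subset_closure hy, subset_tsupport u huy⟩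
  have hz : ∀ y ∈ frontier D, u y = 0 := fun y hy =>
    image_eq_zero_of_notMem_tsupport fun hh => hV hh hy
  have hΛ : ∫ y in D, fderiv ℝ u y v = 0 := by
    have h1 := hnn v
    have h2 := hnn (-v)
    simp only [map_neg, integral_neg] at h2
    linarith
  have hS : ∫ y in frontier D, u y * ⟪N y, v⟫ ∂μHE[d] = 0 :=
    setIntegral_eq_zero_of_forall_eq_zero fun y hy => by rw [hz y hy, zero_mul]
  rw [hΛ, hS, sub_zero, abs_zero]
  have : 0 ≤ ∫ y in frontier D, u y ∂μHE[d] := integral_nonneg h0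
  positivity

/-- With a partition of unity `χ`, the local errors are proportional to the surface integrals of the
`χ i * u`, and these add up to the surface integral of `u`. -/
theorem gaussGreen_of_nonneg (h : IsFlatDomain D N) {d : ℕ}
    (hd : Module.finrank ℝ E = d + 1) {u : E → ℝ} (hu : ContDiff ℝ 1 u)
    (hc : HasCompactSupport u) (h0 : ∀ y, 0 ≤ u y) (v : E) :
    ∫ y in D, fderiv ℝ u y v = ∫ y in frontier D, u y * ⟪N y, v⟫ ∂μHE[d] := by
  set I := ∫ y in frontier D, u y ∂μHE[d] with hI
  have key : ∀ ε : ℝ, 0 < ε → ε ≤ 1 / 2 →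
      |(∫ y in D, fderiv ℝ u y v) - ∫ y in frontier D, u y * ⟪N y, v⟫ ∂μHE[d]| ≤
        (d + 3) * ε * ‖v‖ * I := by
    intro ε hε hε2
    choose V hV hyV hest using fun y₀ => h.exists_nhds_estimate hd y₀ hε hε2
    obtain ⟨s, χ, hχ, hχ0, hχV, hχ1⟩ := exists_contDiff_partition hc.isCompact hV hyV
    have hui : ∀ i, ContDiff ℝ 1 (fun y => χ i y * u y) := fun i =>
      ((hχ i).of_le (by simp)).mul hu
    have hci : ∀ i, HasCompactSupport (fun y => χ i y * u y) := fun i => hc.mul_left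
    have hsum : ∀ y, u y = ∑ i ∈ s, χ i y * u y := fun y => by
      by_cases hy : y ∈ tsupport u
      · rw [← Finset.sum_mul, hχ1 y hy, one_mul]
      · simp [image_eq_zero_of_notMem_tsupport hy]
    have hf : ∀ y, fderiv ℝ u y v = ∑ i ∈ s, fderiv ℝ (fun y => χ i y * u y) y v := fun y => by
      conv_lhs => rw [show u = fun y => ∑ i ∈ s, χ i y * u y from funext hsum]
      rw [fderiv_fun_sum fun i _ => (hui i).differentiable (by simp) y,
        sum_apply]
    have e1 : ∫ y in D, fderiv ℝ u y v =
        ∑ i ∈ s, ∫ y in D, fderiv ℝ (fun y => χ i y * u y) y v := by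
      simp_rw [hf]
      exact integral_finsetSum _ fun i _ =>
        (integrable_fderiv_apply (hui i) (hci i) v).integrableOn
    have e2 : ∫ y in frontier D, u y * ⟪N y, v⟫ ∂μHE[d] =
        ∑ i ∈ s, ∫ y in frontier D, χ i y * u y * ⟪N y, v⟫ ∂μHE[d] := by
      rw [← integral_finsetSum _ fun i _ => h.integrableOn_inner hd (hui i).continuous v]
      refine integral_congr_ae (Eventually.of_forall fun y => ?_)
      dsimp only
      rw [← Finset.sum_mul, ← hsum]
    have e3 : I = ∑ i ∈ s, ∫ y in frontier D, χ i y * u y ∂μHE[d] := by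
      rw [← integral_finsetSum _ fun i _ =>
        h.integrableOn_frontier hd (hui i).continuous.continuousOn, hI]
      exact integral_congr_ae (Eventually.of_forall hsum)
    rw [e1, e2, ← Finset.sum_sub_distrib, e3, Finset.mul_sum]
    refine (Finset.abs_sum_le_sum_abs _ _).trans (Finset.sum_le_sum fun i _ => ?_)
    exact hest i _ (hui i) (hci i) (fun y => mul_nonneg (hχ0 i y) (h0 y))
      ((tsupport_mul_subset_left).trans (hχV i)) v
  have hlim : Tendsto (fun ε : ℝ => (d + 3) * ε * ‖v‖ * I) (𝓝[>] 0) (𝓝 0) := by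
    have : ContinuousAt (fun ε : ℝ => (d + 3) * ε * ‖v‖ * I) 0 := by fun_prop
    simpa [ContinuousAt] using this.mono_left nhdsWithin_le_nhds
  refine sub_eq_zero.1 (abs_nonpos_iff.1 (ge_of_tendsto hlim ?_))
  filter_upwards [Ioc_mem_nhdsGT (show (0 : ℝ) < 1 / 2 by norm_num)] with ε hε
  exact key ε hε.1 hε.2

/-- The Gauss–Green formula for functions of class `C¹` with compact support. -/
theorem gaussGreen (h : IsFlatDomain D N) {d : ℕ}
    (hd : Module.finrank ℝ E = d + 1) {u : E → ℝ} (hu : ContDiff ℝ 1 u)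
    (hc : HasCompactSupport u) (v : E) :
    ∫ y in D, fderiv ℝ u y v = ∫ y in frontier D, u y * ⟪N y, v⟫ ∂μHE[d] := by
  obtain ⟨R, hR⟩ := hc.isCompact.isBounded.subset_closedBall (0 : E)
  obtain ⟨M, hM⟩ := hu.continuous.bounded_above_of_compact_support hc
  have hM0 : 0 ≤ M := (norm_nonneg _).trans (hM 0)
  let b : ContDiffBump (0 : E) := ⟨max R 1, max R 1 + 1, by positivity, by linarith⟩
  have hb : ContDiff ℝ 1 (fun y => M * b y) := contDiff_const.mul b.contDiff
  have hbc : HasCompactSupport (fun y => M * b y) := b.hasCompactSupport.mul_left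
  have hs : ContDiff ℝ 1 (fun y => u y + M * b y) := hu.add hb
  have hsc : HasCompactSupport (fun y => u y + M * b y) := hc.add hbc
  -- `u` is the difference of the nonnegative functions `u + M b` and `M b`.
  have h1 := h.gaussGreen_of_nonneg hd hs hsc (fun y => by
    by_cases hy : y ∈ tsupport u
    · have : b y = 1 := b.one_of_mem_closedBall
        (Metric.closedBall_subset_closedBall (le_max_left _ _) (hR hy))
      simp only [this]
      linarith [(abs_le.1 (hM y)).1]
    · simp only [image_eq_zero_of_notMem_tsupport hy, zero_add]
      exact mul_nonneg hM0 b.nonneg) v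
  have h2 := h.gaussGreen_of_nonneg hd hb hbc (fun y => mul_nonneg hM0 b.nonneg) v
  have e1 : ∀ y, fderiv ℝ (fun y => u y + M * b y) y v =
      fderiv ℝ u y v + fderiv ℝ (fun y => M * b y) y v := fun y => by
    rw [fderiv_fun_add (hu.differentiable (by simp) y) (hb.differentiable (by simp) y)]
    rfl
  simp_rw [e1] at h1
  rw [integral_add (integrable_fderiv_apply hu hc v).integrableOn
    (integrable_fderiv_apply hb hbc v).integrableOn, h2] at h1
  simp_rw [add_mul] at h1
  rw [integral_add (h.integrableOn_inner hd hu.continuous v)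
    (h.integrableOn_inner hd hb.continuous v)] at h1
  linarith

end IsFlatDomain

end GaussGreen

/-! ### The divergence theorem for fields of class `C¹` in the interior -/

section DivergenceTheorem

open Filter Topology Set
open scoped RealInnerProductSpace NNReal ENNReal Manifold

theorem tendsto_setIntegral_of_continuousOn {X F : Type*} [TopologicalSpace X]
    [MeasurableSpace X] [OpensMeasurableSpace X] [NormedAddCommGroup F] [NormedSpace ℝ F]
    {μ : Measure X} {K S : Set X} (hK : IsCompact K) (hS : MeasurableSet S) (hSK : S ⊆ K)
    (hμ : μ S ≠ ⊤) {f : ℝ → X → F}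
    (hf : ContinuousOn (fun p : ℝ × X => f p.1 p.2) (Icc 0 1 ×ˢ K)) :
    Tendsto (fun t => ∫ y in S, f t y ∂μ) (𝓝[>] 0) (𝓝 (∫ y in S, f 0 y ∂μ)) := by
  obtain ⟨M, hM⟩ := (isCompact_Icc.prod hK).exists_bound_of_continuousOn hf
  have hfin : IsFiniteMeasure (μ.restrict S) := ⟨by simpa using hμ.lt_top⟩
  have hmem : ∀ᶠ t : ℝ in 𝓝[>] 0, t ∈ Icc (0 : ℝ) 1 := by
    filter_upwards [Ioc_mem_nhdsGT (show (0 : ℝ) < 1 by norm_num)] with t ht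
    exact ⟨ht.1.le, ht.2⟩
  refine tendsto_integral_filter_of_dominated_convergence (fun _ => M) ?_ ?_
    (integrable_const _) ?_
  · filter_upwards [hmem] with t ht
    refine ContinuousOn.aestronglyMeasurable_of_subset_isCompact
      (hf.comp (f := fun y => (t, y)) (by fun_prop) fun y hy => ⟨ht, hy⟩) hK hS hSK
  · filter_upwards [hmem] with t ht
    exact (ae_restrict_iff' hS).2 (Eventually.of_forall fun y hy => hM (t, y) ⟨ht, hSK hy⟩)
  · refine (ae_restrict_iff' hS).2 (Eventually.of_forall fun y hy => ?_)
    have h1 : ContinuousOn (fun t => f t y) (Icc 0 1) :=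
      hf.comp (f := fun t => (t, y)) (by fun_prop) fun t ht => ⟨ht, hSK hy⟩
    exact (h1 0 ⟨le_rfl, zero_le_one⟩).mono_left
      (nhdsWithin_le_iff.2 hmem)

theorem exists_contDiff_cutoff {E : Type*} [NormedAddCommGroup E] [NormedSpace ℝ E]
    [FiniteDimensional ℝ E] {K Ω : Set E} (hK : IsCompact K) (hΩ : IsOpen Ω) (hKΩ : K ⊆ Ω) :
    ∃ θ : E → ℝ, ContDiff ℝ 1 θ ∧ HasCompactSupport θ ∧ tsupport θ ⊆ Ω ∧ ∀ y ∈ K, θ y = 1 := by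
  obtain ⟨L, hL, hKL, hLΩ⟩ := exists_compact_between hK hΩ hKΩ
  obtain ⟨f, h1, h2, -⟩ := exists_contMDiffMap_one_nhds_of_subset_interior 𝓘(ℝ, E) (n := 1)
    hK.isClosed hKL
  have hs : tsupport f ⊆ L := closure_minimal (fun x hx => by
    by_contra hxL
    exact hx (h2 x hxL)) hL.isClosed
  exact ⟨f, f.contMDiff.contDiff, hL.of_isClosed_subset (isClosed_tsupport _) hs, hs.trans hLΩ,
    fun y hy => h1.self_of_nhdsSet y hy⟩

variable {E : Type*} [NormedAddCommGroup E] [InnerProductSpace ℝ E] [FiniteDimensional ℝ E]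
  [MeasurableSpace E] [BorelSpace E] {D : Set E} {N : E → E}

namespace IsFlatDomain

/-- The Gauss–Green formula for a product `χ g`, where `g` need only be defined and of class `C¹`
near the part of the closure of `D` on which `χ` lives. -/
theorem gaussGreen_mul (h : IsFlatDomain D N) {d : ℕ} (hd : Module.finrank ℝ E = d + 1)
    {χ g : E → ℝ} (hχ : ContDiff ℝ 1 χ) {Ω : Set E} (hΩ : IsOpen Ω) (hg : ContDiffOn ℝ 1 g Ω)
    (hsub : closure D ∩ tsupport χ ⊆ Ω) (v : E) :
    IntegrableOn (fun y => fderiv ℝ (fun z => χ z * g z) y v) D ∧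
    ∫ y in D, fderiv ℝ (fun z => χ z * g z) y v =
      ∫ y in frontier D, χ y * g y * ⟪N y, v⟫ ∂μHE[d] := by
  have hK : IsCompact (closure D ∩ tsupport χ) :=
    h.isBounded.isCompact_closure.inter_right (isClosed_tsupport χ)
  obtain ⟨θ, hθ, hθc, hθs, hθ1⟩ := exists_contDiff_cutoff hK hΩ hsub
  set u : E → ℝ := fun z => θ z * (χ z * g z) with hu
  have huc : HasCompactSupport u := hθc.mul_right
  have hud : ContDiff ℝ 1 u := contDiff_iff_contDiffAt.2 fun y => by
    by_cases hy : y ∈ Ω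
    · exact hθ.contDiffAt.mul (hχ.contDiffAt.mul (hg.contDiffAt (hΩ.mem_nhds hy)))
    · have : u =ᶠ[𝓝 y] fun _ => 0 := by
        filter_upwards [(isClosed_tsupport θ).isOpen_compl.mem_nhds fun hh => hy (hθs hh)] with z hz
        simp [hu, image_eq_zero_of_notMem_tsupport hz]
      exact contDiffAt_const.congr_of_eventuallyEq this
  have hueq : ∀ y ∈ closure D, u y = χ y * g y := fun y hy => by
    by_cases hyχ : y ∈ tsupport χ
    · simp [hu, hθ1 y ⟨hy, hyχ⟩]
    · simp [hu, image_eq_zero_of_notMem_tsupport hyχ]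
  have hfd : EqOn (fun y => fderiv ℝ u y v) (fun y => fderiv ℝ (fun z => χ z * g z) y v) D := by
    intro y hy
    have : u =ᶠ[𝓝 y] fun z => χ z * g z := by
      filter_upwards [h.isOpen.mem_nhds hy] with z hz using hueq z (subset_closure hz)
    simp only [this.fderiv_eq]
  refine ⟨(integrable_fderiv_apply hud huc v).integrableOn.congr_fun hfd h.isOpen.measurableSet, ?_⟩
  rw [← setIntegral_congr_fun h.isOpen.measurableSet hfd, h.gaussGreen hd hud huc v]
  exact setIntegral_congr_fun isClosed_frontier.measurableSet fun y hy => by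
    simp only [hueq y (frontier_subset_closure hy)]

omit [FiniteDimensional ℝ E] [MeasurableSpace E] [BorelSpace E] in
/-- Each point has a neighbourhood in which the closure of `D` is moved into `D` by small
translations in a fixed direction. -/
theorem exists_nhds_shift (h : IsFlatDomain D N) (y₀ : E) :
    ∃ (V : Set E) (w : E), IsOpen V ∧ y₀ ∈ V ∧ ∀ K ⊆ V, IsCompact K →
      ∀ᶠ t : ℝ in 𝓝[>] 0, ∀ y ∈ closure D ∩ K, y - t • w ∈ D := by
  by_cases hy₀ : y₀ ∈ frontier D
  · obtain ⟨ρ, r, hρ⟩ := h.exists_flat y₀ hy₀ (1 / 2) (by norm_num) (by norm_num)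
    refine ⟨Metric.ball y₀ r, N y₀, Metric.isOpen_ball, Metric.mem_ball_self hρ.pos,
      fun K hKV hK => ?_⟩
    filter_upwards [nhdsWithin_le_nhds (eventually_sub_smul_mem Metric.isOpen_ball hK hKV (N y₀)),
      self_mem_nhdsWithin] with t ht ht0 y hy
    have ht0' : (0 : ℝ) < t := ht0
    have hle : ρ y ≤ 0 := by
      by_cases hyD : y ∈ D
      · exact ((hρ.mem_iff y (hKV hy.2)).1 hyD).le
      · refine ((hρ.mem_frontier_iff h.isOpen (hKV hy.2)).1 ?_).le
        rw [h.isOpen.frontier_eq]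
        exact ⟨hy.1, hyD⟩
    refine (hρ.mem_iff _ (ht y hy.2)).2
      ((hρ.lt_of_cone (hKV hy.2) (ht y hy.2) ?_).trans_le hle)
    rw [norm_smul, real_inner_smul_right, real_inner_self_eq_norm_sq, hρ.norm_eq, Real.norm_eq_abs,
      abs_of_pos ht0']
    linarith
  · refine ⟨(frontier D)ᶜ, 0, isClosed_frontier.isOpen_compl, hy₀, fun K hKV hK => ?_⟩
    refine Eventually.of_forall fun t y hy => ?_
    rw [smul_zero, sub_zero]
    by_contra hyD
    exact hKV hy.2 (by rw [h.isOpen.frontier_eq]; exact ⟨hy.1, hyD⟩)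

/-- The divergence theorem for `χ G`, where the cutoff function `χ` has small support. The field `G`
need not be differentiable up to the boundary: its translates `G (· - t w)` into the domain are, and
`t` tends to `0`. -/
theorem divergence_cutoff (h : IsFlatDomain D N) {d : ℕ} (hd : Module.finrank ℝ E = d + 1)
    {ι : Type*} [Fintype ι] (e : ι → E) {G : ι → E → ℝ} {k : E → ℝ} (hG : ∀ j, Continuous (G j))
    (hGd : ∀ j, ContDiffOn ℝ 1 (G j) D) (hk : Continuous k)
    (hdiv : ∀ y ∈ D, ∑ j, fderiv ℝ (G j) y (e j) = k y) {χ : E → ℝ} (hχ : ContDiff ℝ 1 χ) {w : E}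
    (hw : ∀ᶠ t : ℝ in 𝓝[>] 0, ∀ y ∈ closure D ∩ tsupport χ, y - t • w ∈ D) :
    ∫ y in D, (∑ j, fderiv ℝ χ y (e j) * G j y + χ y * k y) =
      ∫ y in frontier D, χ y * ∑ j, G j y * ⟪N y, e j⟫ ∂μHE[d] := by
  have hχ' : ∀ j, Continuous fun y => fderiv ℝ χ y (e j) := fun j =>
    (hχ.continuous_fderiv (by simp)).clm_apply continuous_const
  have hχc := hχ.continuous
  have l1 := tendsto_setIntegral_of_continuousOn (μ := (volume : Measure E))
    (f := fun t y => ∑ j, fderiv ℝ χ y (e j) * G j (y - t • w) + χ y * k (y - t • w))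
    h.isBounded.isCompact_closure h.isOpen.measurableSet subset_closure h.volume_ne_top
    (Continuous.continuousOn (by
      refine .add (continuous_finsetSum _ fun j _ => ?_) ?_
      · exact ((hχ' j).comp continuous_snd).mul ((hG j).comp (by fun_prop))
      · exact (hχc.comp continuous_snd).mul (hk.comp (by fun_prop))))
  have l2 := tendsto_setIntegral_of_continuousOn (μ := (μHE[d] : Measure E))
    (f := fun t y => χ y * ∑ j, G j (y - t • w) * ⟪N y, e j⟫)
    h.isCompact_frontier isClosed_frontier.measurableSet subset_rfl (h.measure_frontier_ne_top hd)
    (by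
      refine (hχc.comp continuous_snd).continuousOn.mul (continuousOn_finsetSum _ fun j _ => ?_)
      refine (((hG j).comp (by fun_prop : Continuous fun p : ℝ × E => p.2 - p.1 • w)
        ).continuousOn).mul ?_
      exact (h.continuousOn.comp continuous_snd.continuousOn fun p hp => hp.2).inner
        continuousOn_const)
  simp only [zero_smul, sub_zero] at l1 l2
  refine tendsto_nhds_unique_of_eventuallyEq l1 l2 ?_
  filter_upwards [hw] with t ht
  -- For small `t > 0`, the translates are of class `C¹` on the open set `D + t w`, which contains
  -- the part of the closure of `D` on which `χ` lives.
  set τ : E → E := fun y => y - t • w with hτ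
  have hτd : ∀ y, HasFDerivAt τ (ContinuousLinearMap.id ℝ E) y := fun y =>
    (hasFDerivAt_id y).sub_const _
  set Ω : Set E := τ ⁻¹' D with hΩ
  have hΩo : IsOpen Ω := h.isOpen.preimage (by fun_prop)
  have hgd : ∀ j, ContDiffOn ℝ 1 (fun y => G j (τ y)) Ω := fun j =>
    (hGd j).comp (by fun_prop) fun y hy => hy
  have main := fun j => h.gaussGreen_mul hd hχ hΩo (hgd j) ht (e j)
  have e1 : ∀ y ∈ D, ∑ j, fderiv ℝ (fun z => χ z * G j (τ z)) y (e j) =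
      ∑ j, fderiv ℝ χ y (e j) * G j (τ y) + χ y * k (τ y) := by
    intro y hy
    by_cases hyχ : y ∈ tsupport χ
    · have hyD : τ y ∈ D := ht y ⟨subset_closure hy, hyχ⟩
      have hder : ∀ j, fderiv ℝ (fun z => χ z * G j (τ z)) y (e j) =
          fderiv ℝ χ y (e j) * G j (τ y) + χ y * fderiv ℝ (G j) (τ y) (e j) := fun j => by
        have d1 := (hχ.differentiable (by simp) y).hasFDerivAt
        have d2 := (((hGd j).contDiffAt (h.isOpen.mem_nhds hyD)).differentiableAt
          (by simp)).hasFDerivAt.comp y (hτd y)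
        have d3 := (d1.mul d2).fderiv
        have : (fun z => χ z * G j (τ z)) = χ * (G j ∘ τ) := rfl
        rw [this, d3]
        simp
        ring
      simp_rw [hder, Finset.sum_add_distrib, ← Finset.mul_sum, hdiv _ hyD]
    · have hz : ∀ j, fderiv ℝ (fun z => χ z * G j (τ z)) y (e j) = 0 := fun j => by
        have : (fun z => χ z * G j (τ z)) =ᶠ[𝓝 y] fun _ => 0 := by
          filter_upwards [(isClosed_tsupport χ).isOpen_compl.mem_nhds hyχ] with z hz
          simp [image_eq_zero_of_notMem_tsupport hz]
        rw [this.fderiv_eq]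
        simp
      simp [hz, image_eq_zero_of_notMem_tsupport hyχ, fderiv_of_notMem_tsupport (𝕜 := ℝ) hyχ]
  change ∫ y in D, (∑ j, fderiv ℝ χ y (e j) * G j (τ y) + χ y * k (τ y)) =
    ∫ y in frontier D, χ y * ∑ j, G j (τ y) * ⟪N y, e j⟫ ∂μHE[d]
  rw [← setIntegral_congr_fun h.isOpen.measurableSet e1,
    integral_finsetSum _ fun j _ => (main j).1, Finset.sum_congr rfl fun j _ => (main j).2,
    ← integral_finsetSum]
  · refine integral_congr_ae (Eventually.of_forall fun y => ?_)
    simp only [Finset.mul_sum, mul_assoc]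
  · intro j _
    refine h.integrableOn_frontier hd ((hχc.mul ((hG j).comp (by fun_prop))).continuousOn.mul ?_)
    exact h.continuousOn.inner continuousOn_const

/-- The divergence theorem for a real vector field with components `G j` along the vectors `e j`,
of class `C¹` in the interior only. -/
theorem divergence_real (h : IsFlatDomain D N) {d : ℕ} (hd : Module.finrank ℝ E = d + 1)
    {ι : Type*} [Fintype ι] (e : ι → E) {G : ι → E → ℝ} {k : E → ℝ} (hG : ∀ j, Continuous (G j))
    (hGd : ∀ j, ContDiffOn ℝ 1 (G j) D) (hk : Continuous k)
    (hdiv : ∀ y ∈ D, ∑ j, fderiv ℝ (G j) y (e j) = k y) :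
    ∫ y in D, k y = ∫ y in frontier D, ∑ j, G j y * ⟪N y, e j⟫ ∂μHE[d] := by
  choose V w hV hyV hshift using h.exists_nhds_shift
  obtain ⟨s, χ, hχ, -, hχV, hχ1⟩ := exists_contDiff_partition h.isBounded.isCompact_closure hV hyV
  have hχd : ∀ i, ContDiff ℝ 1 (χ i) := fun i => (hχ i).of_le (by simp)
  have main : ∀ i, _ := fun i => h.divergence_cutoff hd e hG hGd hk hdiv (hχd i) (w := w i) (by
    have hc := h.isBounded.isCompact_closure.inter_right (isClosed_tsupport (χ i))
    filter_upwards [hshift i _ (inter_subset_right.trans (hχV i)) hc] with t ht y hy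
    exact ht y ⟨hy.1, hy⟩)
  have hsum : ∀ y ∈ D, ∀ v, ∑ i ∈ s, fderiv ℝ (χ i) y v = 0 := by
    intro y hy v
    have : (fun z => ∑ i ∈ s, χ i z) =ᶠ[𝓝 y] fun _ => 1 := by
      filter_upwards [h.isOpen.mem_nhds hy] with z hz using hχ1 z (subset_closure hz)
    have h2 := this.fderiv_eq (𝕜 := ℝ)
    rw [fderiv_fun_sum fun i _ => (hχd i).differentiable (by simp) y] at h2
    rw [← sum_apply, h2]
    simp
  have e1 : ∀ y ∈ D, k y =
      ∑ i ∈ s, (∑ j, fderiv ℝ (χ i) y (e j) * G j y + χ i y * k y) := by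
    intro y hy
    rw [Finset.sum_add_distrib, Finset.sum_comm, ← Finset.sum_mul, hχ1 y (subset_closure hy)]
    simp_rw [← Finset.sum_mul, hsum y hy]
    simp
  have e2 : ∀ y ∈ frontier D, ∑ j, G j y * ⟪N y, e j⟫ =
      ∑ i ∈ s, χ i y * ∑ j, G j y * ⟪N y, e j⟫ := by
    intro y hy
    rw [← Finset.sum_mul, hχ1 y (frontier_subset_closure hy), one_mul]
  rw [setIntegral_congr_fun h.isOpen.measurableSet e1,
    setIntegral_congr_fun isClosed_frontier.measurableSet e2,
    integral_finsetSum, integral_finsetSum]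
  · exact Finset.sum_congr rfl fun i _ => main i
  · intro i _
    refine h.integrableOn_frontier hd ((hχd i).continuous.continuousOn.mul
      (continuousOn_finsetSum _ fun j _ => (hG j).continuousOn.mul ?_))
    exact h.continuousOn.inner continuousOn_const
  · intro i _
    have hc : Continuous fun y => ∑ j, fderiv ℝ (χ i) y (e j) * G j y + χ i y * k y := by
      refine .add (continuous_finsetSum _ fun j _ => ?_) ((hχd i).continuous.mul hk)
      exact (((hχd i).continuous_fderiv (by simp)).clm_apply continuous_const).mul (hG j)
    exact (hc.continuousOn.integrableOn_compact h.isBounded.isCompact_closure).mono_set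
      subset_closure

/-- The divergence theorem for fields with values in a finite-dimensional space that are continuous
on the closure of the domain and of class `C¹` in the interior, with a divergence that extends
continuously to the closure. -/
theorem divergence_theorem (h : IsFlatDomain D N) {d : ℕ} (hd : Module.finrank ℝ E = d + 1)
    {F : Type*} [NormedAddCommGroup F] [NormedSpace ℝ F] [FiniteDimensional ℝ F]
    {ι : Type*} [Fintype ι] (e : ι → E) {G : ι → E → F} {k : E → F}
    (hG : ∀ j, ContinuousOn (G j) (closure D)) (hGd : ∀ j, ContDiffOn ℝ 1 (G j) D)
    (hk : ContinuousOn k (closure D))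
    (hdiv : ∀ y ∈ D, ∑ j, fderiv ℝ (G j) y (e j) = k y) :
    ∫ y in D, k y = ∫ y in frontier D, ∑ j, ⟪N y, e j⟫ • G j y ∂μHE[d] := by
  have : CompleteSpace F := FiniteDimensional.complete ℝ F
  refine (SeparatingDual.eq_iff_forall_dual_eq (R := ℝ)).2 fun ℓ => ?_
  -- Extending the components to continuous functions on the whole space makes all translates
  -- continuous.
  have ext : ∀ f : E → F, ContinuousOn f (closure D) →
      ∃ g : E → ℝ, Continuous g ∧ ∀ y ∈ closure D, g y = ℓ (f y) := by
    intro f hf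
    obtain ⟨g, hg⟩ := ContinuousMap.exists_restrict_eq (isClosed_closure (s := D))
      ⟨_, continuousOn_iff_continuous_domRestrict.1 (ℓ.continuous.comp_continuousOn hf)⟩
    exact ⟨g, g.continuous, fun y hy => DFunLike.congr_fun hg ⟨y, hy⟩⟩
  choose G' hG'c hG' using fun j => ext (G j) (hG j)
  obtain ⟨k', hk'c, hk'⟩ := ext k hk
  have hint1 : IntegrableOn k D := (hk.integrableOn_compact h.isBounded.isCompact_closure).mono_set
    subset_closure
  have hint2 : IntegrableOn (fun y => ∑ j, ⟪N y, e j⟫ • G j y) (frontier D) μHE[d] :=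
    h.integrableOn_frontier hd (continuousOn_finsetSum _ fun j _ =>
      (h.continuousOn.inner continuousOn_const).smul ((hG j).mono frontier_subset_closure))
  rw [← ℓ.integral_comp_comm hint1, ← ℓ.integral_comp_comm hint2,
    ← setIntegral_congr_fun h.isOpen.measurableSet fun y hy => hk' y (subset_closure hy)]
  have hev : ∀ j, ∀ y ∈ D, G' j =ᶠ[𝓝 y] fun z => ℓ (G j z) := fun j y hy => by
    filter_upwards [h.isOpen.mem_nhds hy] with z hz using hG' j z (subset_closure hz)
  rw [h.divergence_real hd e hG'c (fun j => ?_) hk'c fun y hy => ?_]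
  · refine setIntegral_congr_fun isClosed_frontier.measurableSet fun y hy => ?_
    simp [hG' _ y (frontier_subset_closure hy), mul_comm]
  · exact (ℓ.contDiff.comp_contDiffOn (hGd j)).congr fun y hy => hG' j y (subset_closure hy)
  · rw [hk' y (subset_closure hy), ← hdiv y hy, map_sum]
    refine Finset.sum_congr rfl fun j _ => ?_
    rw [(hev j y hy).fderiv_eq]
    have := (ℓ.hasFDerivAt.comp y (((hGd j).contDiffAt (h.isOpen.mem_nhds hy)).differentiableAt
          (by simp)).hasFDerivAt).fderiv
    change fderiv ℝ (ℓ ∘ G j) y (e j) = _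
    rw [this]
    rfl

end IsFlatDomain

end DivergenceTheorem

/-! ### Domains with smooth boundary -/

section SmoothDomain

open Filter Topology Set
open scoped RealInnerProductSpace

variable {n : ℕ} {D U : Set (EuclideanSpace ℝ (Fin n))} {ρ : EuclideanSpace ℝ (Fin n) → ℝ}

theorem IsLocalDefiningFunction.outwardNormal_eq (h : IsLocalDefiningFunction D U ρ)
    (hD : IsOpen D) {y : EuclideanSpace ℝ (Fin n)} (hy : y ∈ frontier D) (hyU : y ∈ U) :
    outwardNormal D y = ‖gradient ρ y‖⁻¹ • gradient ρ y := by
  have hex : IsOutwardNormal D y (‖gradient ρ y‖⁻¹ • gradient ρ y) := ⟨U, ρ, hyU, h, rfl⟩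
  exact IsOutwardNormal.unique hD hy
    (Classical.epsilon_spec (p := IsOutwardNormal D y) ⟨_, hex⟩) hex

theorem IsLocalDefiningFunction.continuousOn_gradient (h : IsLocalDefiningFunction D U ρ) :
    ContinuousOn (gradient ρ) U :=
  (InnerProductSpace.toDual ℝ (EuclideanSpace ℝ (Fin n))).symm.continuous.comp_continuousOn
    (h.contDiffOn.continuousOn_fderiv_of_isOpen h.isOpen (by simp))

theorem IsLocalDefiningFunction.exists_isFlatAt (h : IsLocalDefiningFunction D U ρ)
    (hD : IsOpen D) {y : EuclideanSpace ℝ (Fin n)} (hy : y ∈ frontier D) (hyU : y ∈ U)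
    {ε : ℝ} (hε : 0 < ε) (hε1 : ε < 1) :
    ∃ r, IsFlatAt D (fun z => ‖gradient ρ y‖⁻¹ * ρ z) y (outwardNormal D y) ε r := by
  have hg : 0 < ‖gradient ρ y‖ := norm_pos_iff.2 (h.gradient_ne_zero y hyU)
  have hc : ContDiffAt ℝ ∞ ρ y := h.contDiffOn.contDiffAt (h.isOpen.mem_nhds hyU)
  have hs : HasStrictFDerivAt ρ (InnerProductSpace.toDual ℝ _ (gradient ρ y)) y := by
    have := hc.hasStrictFDerivAt (by simp)
    rwa [gradient, LinearIsometryEquiv.apply_symm_apply]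
  obtain ⟨s, hsy, happ⟩ := hs.approximates_deriv_on_nhds
    (c := (ε * ‖gradient ρ y‖).toNNReal) (Or.inr (by simpa using mul_pos hε hg))
  obtain ⟨r, hr, hrs⟩ := Metric.mem_nhds_iff.1 (inter_mem hsy (h.isOpen.mem_nhds hyU))
  rw [h.outwardNormal_eq hD hy hyU]
  refine ⟨r, ?_, hε.le, hε1, hr, fun a ha b hb => ?_, ?_, fun a ha => ?_⟩
  · rw [norm_smul, norm_inv, norm_norm, inv_mul_cancel₀ hg.ne']
  · have := happ a (hrs ha).1 b (hrs hb).1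
    rw [InnerProductSpace.toDual_apply_apply, Real.coe_toNNReal _ (by positivity),
      Real.norm_eq_abs] at this
    rw [real_inner_smul_left, ← mul_sub, ← mul_sub, abs_mul, abs_of_pos (inv_pos.2 hg),
      inv_mul_le_iff₀ hg]
    linarith
  · simp only [h.eq_zero hD hy hyU, mul_zero]
  · have haU := (hrs ha).2
    have : a ∈ D ↔ a ∈ {y ∈ U | ρ y < 0} := by rw [← h.inter_eq]; simp [haU]
    rw [this, ← smul_eq_mul, smul_neg_iff_of_pos_left (inv_pos.2 hg)]
    simp [haU]

theorem IsSmoothBoundedDomain.isFlatDomain (h : IsSmoothBoundedDomain D) :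
    IsFlatDomain D (outwardNormal D) where
  isOpen := h.isOpen
  isBounded := h.isBounded
  continuousOn := by
    intro y hy
    obtain ⟨U, ρ, hyU, hρ⟩ := h.exists_defining y hy
    have h1 : ContinuousAt (fun z => ‖gradient ρ z‖⁻¹ • gradient ρ z) y := by
      have hg := hρ.continuousOn_gradient.continuousAt (hρ.isOpen.mem_nhds hyU)
      exact (hg.norm.inv₀ (norm_ne_zero_iff.2 (hρ.gradient_ne_zero y hyU))).smul hg
    refine (h1.continuousWithinAt (s := frontier D)).congr_of_eventuallyEq ?_
      (hρ.outwardNormal_eq h.isOpen hy hyU)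
    filter_upwards [mem_nhdsWithin_of_mem_nhds (hρ.isOpen.mem_nhds hyU), self_mem_nhdsWithin]
      with z hzU hz
    exact hρ.outwardNormal_eq h.isOpen hz hzU
  exists_flat := by
    intro y hy ε hε hε1
    obtain ⟨U, ρ, hyU, hρ⟩ := h.exists_defining y hy
    exact ⟨_, hρ.exists_isFlatAt h.isOpen hy hyU hε hε1⟩

end SmoothDomain

/-! ### The regularized Cauchy kernel -/

section Kernel

open Filter Topology Set
open scoped RealInnerProductSpace

theorem integral_one_add_norm_sq_pos (n : ℕ) :
    0 < ∫ z : EuclideanSpace ℝ (Fin n), (1 + ‖z‖ ^ 2) ^ (-((n : ℝ) + 2) / 2) := by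
  have hpos : ∀ z : EuclideanSpace ℝ (Fin n), 0 < (1 + ‖z‖ ^ 2) ^ (-((n : ℝ) + 2) / 2) :=
    fun z => Real.rpow_pos_of_pos (by positivity) _
  rw [integral_pos_iff_support_of_nonneg (fun z => (hpos z).le)
    (integrable_rpow_neg_one_add_norm_sq (by simp))]
  rw [show Function.support (fun z : EuclideanSpace ℝ (Fin n) =>
    (1 + ‖z‖ ^ 2) ^ (-((n : ℝ) + 2) / 2)) = univ from eq_univ_of_forall fun z => (hpos z).ne']
  exact isOpen_univ.measure_pos _ univ_nonempty

/-- The constant `λ` for which the kernels `n λ ε² (ε² + ‖y - x‖²) ^ (-(n + 2) / 2)` have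
integral `1`. For `n ≥ 1` it is the inverse of the area of the unit sphere. -/
noncomputable def kernelConst (n : ℕ) : ℝ :=
  ((n : ℝ) * ∫ z : EuclideanSpace ℝ (Fin n), (1 + ‖z‖ ^ 2) ^ (-((n : ℝ) + 2) / 2))⁻¹

/-- The kernels `n λ ε² (ε² + ‖y - x‖²) ^ (-(n + 2) / 2)` form an approximate identity. -/
theorem tendsto_integral_peak {n : ℕ} (hn : n ≠ 0) {F : Type*} [NormedAddCommGroup F]
    [NormedSpace ℝ F] [CompleteSpace F] {g : EuclideanSpace ℝ (Fin n) → F}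
    {x : EuclideanSpace ℝ (Fin n)} (hg : Integrable g) (hgx : ContinuousAt g x) :
    Tendsto (fun ε : ℝ => ∫ y, (n * kernelConst n * ε ^ 2 *
      (ε ^ 2 + ‖y - x‖ ^ 2) ^ (-((n : ℝ) + 2) / 2)) • g y) (𝓝[>] 0) (𝓝 (g x)) := by
  have hI := integral_one_add_norm_sq_pos n
  have hn' : (0 : ℝ) < n := by positivity
  have hk : 0 < n * kernelConst n := mul_pos hn' (inv_pos.2 (mul_pos hn' hI))
  have hlim := tendsto_integral_comp_smul_smul_of_integrable' (μ := volume)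
    (φ := fun z : EuclideanSpace ℝ (Fin n) =>
      n * kernelConst n * (1 + ‖z‖ ^ 2) ^ (-((n : ℝ) + 2) / 2)) (fun z => by positivity) ?_ ?_
    hg hgx
  · refine (hlim.comp tendsto_inv_nhdsGT_zero).congr' ?_
    filter_upwards [self_mem_nhdsWithin] with ε hε
    have hε' : (0 : ℝ) < ε := hε
    refine integral_congr_ae (Eventually.of_forall fun y => ?_)
    dsimp only
    congr 1
    rw [finrank_euclideanSpace_fin, norm_smul, norm_sub_rev x y, norm_inv, Real.norm_eq_abs,
      abs_of_pos hε']
    have e : 1 + (ε⁻¹ * ‖y - x‖) ^ 2 = (ε ^ 2)⁻¹ * (ε ^ 2 + ‖y - x‖ ^ 2) := by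
      field_simp
    have e2 : ((ε ^ 2)⁻¹ : ℝ) ^ (-((n : ℝ) + 2) / 2) = ε ^ (n + 2) := by
      rw [Real.inv_rpow (by positivity), ← Real.rpow_neg (by positivity), ← Real.rpow_natCast ε 2,
        ← Real.rpow_mul hε'.le, ← Real.rpow_natCast]
      congr 1
      push_cast
      ring
    rw [e, Real.mul_rpow (by positivity) (by positivity), e2, pow_add, inv_pow]
    field_simp
  · rw [integral_const_mul, kernelConst]
    have : ∀ I : ℝ, 0 < I → n * (n * I)⁻¹ * I = 1 := fun I hI => by field_simp
    exact this _ hI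
  · have hb : ∀ z : EuclideanSpace ℝ (Fin n), z ≠ 0 →
        ‖z‖ ^ n * (n * kernelConst n * (1 + ‖z‖ ^ 2) ^ (-((n : ℝ) + 2) / 2)) ≤
          n * kernelConst n * (‖z‖⁻¹) ^ 2 := by
      intro z hz
      have hz' : 0 < ‖z‖ := norm_pos_iff.2 hz
      have h1 : (1 + ‖z‖ ^ 2) ^ (-((n : ℝ) + 2) / 2) ≤ (‖z‖ ^ 2) ^ (-((n : ℝ) + 2) / 2) :=
        Real.rpow_le_rpow_of_nonpos (by positivity) (by linarith) (by linarith)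
      have h2 : (‖z‖ ^ 2) ^ (-((n : ℝ) + 2) / 2) = (‖z‖ ^ (n + 2))⁻¹ := by
        rw [← Real.rpow_natCast ‖z‖ 2, ← Real.rpow_mul hz'.le, ← Real.rpow_natCast,
          ← Real.rpow_neg hz'.le]
        congr 1
        push_cast
        ring
      calc _ ≤ ‖z‖ ^ n * (n * kernelConst n * (‖z‖ ^ (n + 2))⁻¹) := by rw [← h2]; gcongr
        _ = _ := by rw [pow_add]; field_simp
    have hlim0 : Tendsto (fun z : EuclideanSpace ℝ (Fin n) => n * kernelConst n * (‖z‖⁻¹) ^ 2)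
        (Bornology.cobounded _) (𝓝 0) := by
      have := ((tendsto_norm_cobounded_atTop (E := EuclideanSpace ℝ (Fin n))).inv_tendsto_atTop.pow
        2).const_mul (n * kernelConst n)
      simpa using this
    rw [finrank_euclideanSpace_fin]
    refine tendsto_of_tendsto_of_tendsto_of_le_of_le' tendsto_const_nhds hlim0
      (Eventually.of_forall fun z => by positivity) ?_
    filter_upwards [Bornology.eventually_ne_cobounded (0 : EuclideanSpace ℝ (Fin n))] with z hz
    exact hb z hz

variable {n : ℕ} {A : Type*} [NormedRing A] [NormedAlgebra ℝ A]

/-- The coefficients `∑ m, aʲₘ bⁱₘ` of the vector field `j ↦ ∑ m, aʲₘ φₘ` are a multiple `c` of the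
identity matrix plus an antisymmetric matrix. -/
def IsConformalPair {q : ℕ} (a b : Matrix (Fin n) (Fin q) A) (c : ℝ) : Prop :=
  ∀ i j, ∑ m, a i m * b j m + ∑ m, a j m * b i m = if i = j then (2 * c) • (1 : A) else 0

/-- The vector field `∑ m, aʲₘ φₘ(x, y)` as a linear function of `h = y - x`. -/
noncomputable def kernelField {q : ℕ} (a b : Matrix (Fin n) (Fin q) A) (j : Fin n) :
    EuclideanSpace ℝ (Fin n) →L[ℝ] A :=
  ∑ i, (EuclideanSpace.proj i : EuclideanSpace ℝ (Fin n) →L[ℝ] ℝ).smulRight (∑ m, a j m * b i m)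

section

variable {q : ℕ} {a b : Matrix (Fin n) (Fin q) A} {c : ℝ}

theorem kernelField_apply (j : Fin n) (h : EuclideanSpace ℝ (Fin n)) :
    kernelField a b j h = ∑ i, h i • ∑ m, a j m * b i m := by
  simp [kernelField]

theorem kernelField_sub (j : Fin n) (x y : EuclideanSpace ℝ (Fin n)) :
    kernelField a b j (y - x) = ∑ m, a j m * phi b m x y := by
  simp_rw [kernelField_apply, phi, Finset.mul_sum, Finset.smul_sum]
  rw [Finset.sum_comm]
  simp

theorem kernelField_single (j i : Fin n) :
    kernelField a b j (EuclideanSpace.single i 1) = ∑ m, a j m * b i m := by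
  rw [kernelField_apply]
  simp [ite_smul]

theorem IsConformalPair.radial (hab : IsConformalPair a b c) (h : EuclideanSpace ℝ (Fin n)) :
    ∑ j, h j • kernelField a b j h = (c * ‖h‖ ^ 2) • (1 : A) := by
  have e1 : ∑ j, h j • kernelField a b j h = ∑ j, ∑ i, (h j * h i) • ∑ m, a j m * b i m := by
    simp_rw [kernelField_apply, Finset.smul_sum, mul_smul]
  have e2 : ∑ j, h j • kernelField a b j h = ∑ j, ∑ i, (h j * h i) • ∑ m, a i m * b j m := by
    rw [e1, Finset.sum_comm]
    simp_rw [mul_comm]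
  have e3 : (2 : ℝ) • ∑ j, h j • kernelField a b j h = (2 : ℝ) • (c * ‖h‖ ^ 2) • (1 : A) := by
    rw [two_smul]
    nth_rewrite 1 [e1]
    rw [e2, ← Finset.sum_add_distrib]
    simp_rw [← Finset.sum_add_distrib, ← smul_add]
    simp_rw [hab _ _]
    simp only [smul_ite, smul_zero, Finset.sum_ite_eq, Finset.mem_univ, if_true, smul_smul]
    rw [← Finset.sum_smul, EuclideanSpace.real_norm_sq_eq, Finset.mul_sum, Finset.mul_sum]
    congr 1
    exact Finset.sum_congr rfl fun i _ => by ring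
  exact smul_right_injective A (two_ne_zero (α := ℝ)) e3

theorem IsConformalPair.trace (hab : IsConformalPair a b c) :
    ∑ j, kernelField a b j (EuclideanSpace.single j 1) = (n * c) • (1 : A) := by
  have : ∀ j, kernelField a b j (EuclideanSpace.single j 1) = c • (1 : A) := fun j => by
    have := hab j j
    rw [if_pos rfl, ← two_smul ℝ, mul_smul] at this
    rw [kernelField_single]
    exact smul_right_injective A (two_ne_zero (α := ℝ)) this
  simp only [this, Finset.sum_const, Finset.card_univ, Fintype.card_fin, mul_smul,
    ← Nat.cast_smul_eq_nsmul ℝ]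

end

end Kernel

/-! ### The Cauchy formula -/

section CauchyFormula

open Filter Topology Set
open scoped RealInnerProductSpace

variable {n q : ℕ} {A : Type*} [NormedRing A] [NormedAlgebra ℝ A]
  {a b : Matrix (Fin n) (Fin q) A} {c : ℝ}

theorem hasFDerivAt_regularized_pow {ε : ℝ} (hε : 0 < ε) (x y : EuclideanSpace ℝ (Fin n)) (s : ℝ) :
    HasFDerivAt (fun z => (ε ^ 2 + ‖z - x‖ ^ 2) ^ s)
      ((s * (ε ^ 2 + ‖y - x‖ ^ 2) ^ (s - 1)) • (2 • innerSL ℝ (y - x))) y := by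
  have h1 : HasFDerivAt (fun z : EuclideanSpace ℝ (Fin n) => ε ^ 2 + ‖z - x‖ ^ 2)
      (2 • innerSL ℝ (y - x)) y := by
    have := ((hasStrictFDerivAt_norm_sq (y - x)).hasFDerivAt.comp y
      ((hasFDerivAt_id y).sub_const x)).const_add (ε ^ 2)
    exact this
  exact h1.rpow_const (Or.inl (by positivity))

/-- The divergence of the regularized Cauchy kernel times a Cauchy function. The Cauchy conditions
remove the derivatives of `f`; the antisymmetric part of the coefficients of the linear vector field
does not contribute. -/
theorem divergence_regularized (hab : IsConformalPair a b c) {ε : ℝ} (hε : 0 < ε)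
    {f : EuclideanSpace ℝ (Fin n) → A} (x y : EuclideanSpace ℝ (Fin n))
    (hf : DifferentiableAt ℝ f y)
    (hcauchy : ∀ m, ∑ j, fderiv ℝ f y (EuclideanSpace.single j 1) * a j m = 0) :
    ∑ j, fderiv ℝ (fun z => f z * ((ε ^ 2 + ‖z - x‖ ^ 2) ^ (-(n : ℝ) / 2) •
        kernelField a b j (z - x))) y (EuclideanSpace.single j 1) =
      (n * c * ε ^ 2 * (ε ^ 2 + ‖y - x‖ ^ 2) ^ (-((n : ℝ) + 2) / 2)) • f y := by
  set R := ε ^ 2 + ‖y - x‖ ^ 2 with hR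
  have hR0 : 0 < R := by positivity
  have hexp : (-(n : ℝ) / 2 - 1) = -((n : ℝ) + 2) / 2 := by ring
  have hpow : R ^ (-(n : ℝ) / 2) = R * R ^ (-((n : ℝ) + 2) / 2) := by
    rw [← hexp, Real.rpow_sub_one hR0.ne']
    field_simp
  have hder : ∀ j, fderiv ℝ (fun z => f z * ((ε ^ 2 + ‖z - x‖ ^ 2) ^ (-(n : ℝ) / 2) •
        kernelField a b j (z - x))) y (EuclideanSpace.single j 1) =
      f y * (R ^ (-(n : ℝ) / 2) • kernelField a b j (EuclideanSpace.single j 1)) -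
        f y * ((n * R ^ (-((n : ℝ) + 2) / 2)) • (y - x) j • kernelField a b j (y - x)) +
        R ^ (-(n : ℝ) / 2) • (fderiv ℝ f y (EuclideanSpace.single j 1) *
          kernelField a b j (y - x)) := fun j => by
    have d1 := hasFDerivAt_regularized_pow hε x y (-(n : ℝ) / 2)
    have d2 : HasFDerivAt (fun z => kernelField a b j (z - x)) (kernelField a b j) y :=
      (kernelField a b j).hasFDerivAt.comp y ((hasFDerivAt_id y).sub_const x)
    have d3 := (hf.hasFDerivAt.mul' (d1.smul d2)).fderiv
    rw [hexp, ← hR] at d3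
    have : (fun z => f z * ((ε ^ 2 + ‖z - x‖ ^ 2) ^ (-(n : ℝ) / 2) •
        kernelField a b j (z - x))) = f * ((fun z => (ε ^ 2 + ‖z - x‖ ^ 2) ^ (-(n : ℝ) / 2)) •
        fun z => kernelField a b j (z - x)) := rfl
    rw [this, d3]
    have hin : ⟪y - x, EuclideanSpace.single j (1 : ℝ)⟫ = (y - x) j := by
      simp [EuclideanSpace.inner_single_right]
    simp only [add_apply, smul_apply,
      ContinuousLinearMap.smulRight_apply, innerSL_apply_apply, hin, smul_eq_mul, mul_add,
      MulOpposite.smul_eq_mul_unop, MulOpposite.unop_op, Pi.smul_apply', ← hR, nsmul_eq_mul,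
      mul_smul_comm, smul_smul]
    have e : (-(n : ℝ) / 2 * R ^ (-((n : ℝ) + 2) / 2) * ((2 : ℕ) * (y - x) j)) =
      -(n * R ^ (-((n : ℝ) + 2) / 2) * (y - x) j) := by push_cast; ring
    rw [e, neg_smul]
    abel
  have hzero : ∑ j, fderiv ℝ f y (EuclideanSpace.single j 1) * kernelField a b j (y - x) = 0 := by
    simp_rw [kernelField_sub, Finset.mul_sum, ← mul_assoc]
    rw [Finset.sum_comm]
    refine Finset.sum_eq_zero fun m _ => ?_
    rw [← Finset.sum_mul, hcauchy m, zero_mul]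
  simp_rw [hder, Finset.sum_add_distrib, Finset.sum_sub_distrib, ← Finset.smul_sum, hzero,
    ← Finset.mul_sum, ← Finset.smul_sum, hab.trace, hab.radial, smul_zero, add_zero, smul_smul,
    mul_smul_comm, mul_one, ← sub_smul, hpow]
  congr 1
  rw [hR]
  ring

theorem cauchyKernel_eq (D : Set (EuclideanSpace ℝ (Fin n))) (x y : EuclideanSpace ℝ (Fin n)) :
    cauchyKernel a b D x y =
      ∑ j, outwardNormal D y j • ((‖y - x‖ ^ n)⁻¹ • kernelField a b j (y - x)) := by
  simp_rw [cauchyKernel, kernelField_sub, Finset.smul_sum, mul_smul_comm]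
  rw [Finset.sum_comm]

/-- The Cauchy formula for coefficients whose vector field `j ↦ ∑ m, aʲₘ φₘ` is, up to an
antisymmetric part, the radial field divided by the area of the unit sphere. -/
theorem hasCauchyFormula_of_isConformalPair [FiniteDimensional ℝ A] (hn : n ≠ 0)
    (hab : IsConformalPair a b (kernelConst n)) :
    HasCauchyFormula a := by
  have : CompleteSpace A := FiniteDimensional.complete ℝ A
  refine ⟨b, fun D hD f hf x hx => ?_⟩
  have hD' := hD.isFlatDomain
  have hd : Module.finrank ℝ (EuclideanSpace ℝ (Fin n)) = n - 1 + 1 := by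
    rw [finrank_euclideanSpace_fin]
    omega
  have hne : ∀ y ∈ frontier D, y - x ≠ 0 := fun y hy h0 => by
    rw [sub_eq_zero] at h0
    rw [hD.isOpen.frontier_eq] at hy
    exact hy.2 (h0 ▸ hx)
  have hfr : ContinuousOn f (frontier D) := hf.continuousOn.mono frontier_subset_closure
  have hNc : ∀ j, ContinuousOn (fun y => outwardNormal D y j) (frontier D) := fun j =>
    (EuclideanSpace.proj (𝕜 := ℝ) j).continuous.comp_continuousOn hD'.continuousOn
  have hψ : ∀ j, Continuous fun y => kernelField a b j (y - x) := fun j =>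
    (kernelField a b j).continuous.comp (by fun_prop)
  constructor
  · refine hD'.integrableOn_frontier hd (hfr.mul ?_)
    rw [funext (cauchyKernel_eq D x)]
    refine continuousOn_finsetSum _ fun j _ => (hNc j).smul (ContinuousOn.smul ?_
      (hψ j).continuousOn)
    refine ContinuousOn.inv₀ (by fun_prop) fun y hy => ?_
    exact pow_ne_zero _ (norm_ne_zero_iff.2 (hne y hy))
  -- The regularized kernels satisfy the divergence theorem on all of `D`; both sides converge.
  set Φ : ℝ → EuclideanSpace ℝ (Fin n) → A := fun ε y => ∑ j, outwardNormal D y j •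
    (f y * ((ε ^ 2 + ‖y - x‖ ^ 2) ^ (-(n : ℝ) / 2) • kernelField a b j (y - x))) with hΦ
  have hdiv : ∀ ε : ℝ, 0 < ε → ∫ y in D, (n * kernelConst n * ε ^ 2 *
      (ε ^ 2 + ‖y - x‖ ^ 2) ^ (-((n : ℝ) + 2) / 2)) • f y =
      ∫ y in frontier D, Φ ε y ∂μHE[n - 1] := by
    intro ε hε
    have hpc : ∀ s : ℝ, ContDiff ℝ 1
        (fun y : EuclideanSpace ℝ (Fin n) => (ε ^ 2 + ‖y - x‖ ^ 2) ^ s) := fun s =>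
      (contDiff_const.add ((contDiff_id.sub contDiff_const).norm_sq ℝ)).rpow_const_of_ne
        fun y => by positivity
    have := hD'.divergence_theorem hd (fun j : Fin n => EuclideanSpace.single j (1 : ℝ))
      (G := fun j z => f z * ((ε ^ 2 + ‖z - x‖ ^ 2) ^ (-(n : ℝ) / 2) • kernelField a b j (z - x)))
      (k := fun y => (n * kernelConst n * ε ^ 2 *
        (ε ^ 2 + ‖y - x‖ ^ 2) ^ (-((n : ℝ) + 2) / 2)) • f y)
      (fun j => hf.continuousOn.mul ((hpc _).continuous.smul (hψ j)).continuousOn)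
      (fun j => hf.contDiffOn.mul ((hpc _).smul ((kernelField a b j).contDiff.comp
        (contDiff_id.sub contDiff_const))).contDiffOn)
      ((continuous_const.mul (hpc _).continuous).continuousOn.smul hf.continuousOn)
      (fun y hy => divergence_regularized hab hε x y
        ((hf.contDiffOn.contDiffAt (hD.isOpen.mem_nhds hy)).differentiableAt (by simp))
        (hf.cauchy y hy))
    rw [this]
    simp [hΦ, EuclideanSpace.inner_single_right]
  have l1 : Tendsto (fun ε : ℝ => ∫ y in D, (n * kernelConst n * ε ^ 2 *
      (ε ^ 2 + ‖y - x‖ ^ 2) ^ (-((n : ℝ) + 2) / 2)) • f y) (𝓝[>] 0) (𝓝 (f x)) := by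
    have hint : Integrable (D.indicator f) :=
      ((hf.continuousOn.integrableOn_compact hD.isBounded.isCompact_closure).mono_set
        subset_closure).integrable_indicator hD.isOpen.measurableSet
    have hev : D.indicator f =ᶠ[𝓝 x] f := by
      filter_upwards [hD.isOpen.mem_nhds hx] with z hz using indicator_of_mem hz f
    have hcont : ContinuousAt (D.indicator f) x :=
      ((hf.continuousOn.mono subset_closure).continuousAt (hD.isOpen.mem_nhds hx)).congr hev.symm
    have := tendsto_integral_peak hn hint hcont
    rw [indicator_of_mem hx] at this
    refine this.congr fun ε => ?_
    rw [← integral_indicator hD.isOpen.measurableSet]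
    refine integral_congr_ae (Eventually.of_forall fun y => ?_)
    by_cases hy : y ∈ D <;> simp [hy]
  have l2 : Tendsto (fun ε : ℝ => ∫ y in frontier D, Φ ε y ∂μHE[n - 1]) (𝓝[>] 0)
      (𝓝 (∫ y in frontier D, Φ 0 y ∂μHE[n - 1])) := by
    refine tendsto_setIntegral_of_continuousOn hD'.isCompact_frontier
      isClosed_frontier.measurableSet subset_rfl (hD'.measure_frontier_ne_top hd)
      (continuousOn_finsetSum _ fun j _ => ?_)
    have hsnd : MapsTo Prod.snd (Icc (0 : ℝ) 1 ×ˢ frontier D) (frontier D) := fun p hp => hp.2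
    refine ((hNc j).comp continuousOn_snd hsnd).smul ((hfr.comp continuousOn_snd hsnd).mul
      (ContinuousOn.smul ?_ ((hψ j).comp continuous_snd).continuousOn))
    refine ContinuousOn.rpow_const (by fun_prop) fun p hp => Or.inl ?_
    have := norm_pos_iff.2 (hne p.2 hp.2)
    positivity
  rw [tendsto_nhds_unique_of_eventuallyEq l1 l2 (by
    filter_upwards [self_mem_nhdsWithin] with ε hε using hdiv ε hε)]
  refine setIntegral_congr_fun isClosed_frontier.measurableSet fun y hy => ?_
  have hy0 := norm_pos_iff.2 (hne y hy)
  have e : ((0 : ℝ) ^ 2 + ‖y - x‖ ^ 2) ^ (-(n : ℝ) / 2) = (‖y - x‖ ^ n)⁻¹ := by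
    rw [zero_pow two_ne_zero, zero_add, ← Real.rpow_natCast ‖y - x‖ 2, ← Real.rpow_mul hy0.le,
      ← Real.rpow_natCast, ← Real.rpow_neg hy0.le]
    congr 1
    push_cast
    ring
  simp only [hΦ, e, cauchyKernel_eq, Finset.mul_sum, mul_smul_comm]

end CauchyFormula

section Algebra

variable {A : Type*} [Ring A] {p : ℕ}

/-- An element of the right ideal generated by the commutators of the `γ m` is a combination of the
products `γ m * γ k` with antisymmetric coefficients. -/
theorem exists_antisymm_of_mem_commutatorRightIdeal {γ : Fin p → A} {z : A}
    (hz : z ∈ commutatorRightIdeal γ) :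
    ∃ S : Fin p → Fin p → A, (∀ k m, S k m = -S m k) ∧ z = ∑ k, ∑ m, γ k * γ m * S k m := by
  induction hz using Submodule.span_induction with
  | mem z hz =>
    obtain ⟨k, m, -, rfl⟩ := hz
    refine ⟨fun i j => (if i = m then if j = k then 1 else 0 else 0) -
      (if i = k then if j = m then 1 else 0 else 0), fun i j => ?_, ?_⟩
    · dsimp only
      rw [neg_sub]
      simp only [← ite_and, and_comm]
    · simp [mul_sub, Finset.sum_sub_distrib]
  | zero => exact ⟨fun _ _ => 0, by simp, by simp⟩
  | add x y _ _ hx hy =>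
    obtain ⟨S, hS, rfl⟩ := hx
    obtain ⟨T, hT, rfl⟩ := hy
    refine ⟨fun i j => S i j + T i j, fun i j => ?_, ?_⟩
    · dsimp only
      rw [hS i j, hT i j, neg_add]
    · simp [mul_add, Finset.sum_add_distrib]
  | smul r x _ hx =>
    obtain ⟨S, hS, rfl⟩ := hx
    refine ⟨fun i j => S i j * r.unop, fun i j => ?_, ?_⟩
    · dsimp only
      rw [hS i j, neg_mul]
    · simp [MulOpposite.smul_eq_mul_unop, Finset.sum_mul, mul_assoc]

end Algebra

section SpecialCoefficients

variable {A : Type*} [NormedRing A] [NormedAlgebra ℝ A] {p : ℕ}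

/-- The condition on the commutators is exactly what is needed to choose the functions `φₘ` such
that the vector field `j ↦ ∑ m, aʲₘ φₘ` is radial up to an antisymmetric part. -/
theorem exists_isConformalPair_specialCoeff (α : Fin p → A) (β : Fin p → Aˣ)
    (h : 1 + ∑ m : Fin p, (α m * (↑(β m)⁻¹ : A)) ^ 2 ∈
      commutatorRightIdeal (fun m : Fin p => α m * (↑(β m)⁻¹ : A))) (c : ℝ) :
    ∃ b, IsConformalPair (specialCoeff α β) b c := by
  set γ : Fin p → A := fun m => α m * (↑(β m)⁻¹ : A) with hγ
  obtain ⟨S, hS, hsum⟩ := exists_antisymm_of_mem_commutatorRightIdeal h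
  -- The rows `m ≥ 1` of the coefficient matrix `B` of the field; the row `0` is `∑ m, γ m * B m`.
  set T : Fin p → Fin p → A := fun m k => c • ((if m = k then 1 else 0) + S m k) with hT
  set r : Fin p → A := fun k => ∑ m, γ m * T m k with hr
  set B : Fin p → Fin (p + 1) → A := fun m => Fin.cons (-r m) (T m) with hB
  refine ⟨Matrix.of fun i m => (↑(β m)⁻¹ : A) * B m i, ?_⟩
  have hTT : ∀ m k, T m k + T k m = if m = k then (2 * c) • (1 : A) else 0 := by
    intro m k
    rw [hT]
    dsimp only
    rw [← smul_add, hS m k]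
    by_cases hmk : m = k
    · subst hmk
      simp only [if_true, mul_comm 2 c, mul_smul]
      rw [two_smul]
      congr 1
      abel
    · simp [hmk, Ne.symm hmk]
  have hrow : ∀ m i, ∑ l, specialCoeff α β (Fin.succ m) l * ((↑(β l)⁻¹ : A) * B l i) = B m i := by
    intro m i
    rw [Finset.sum_eq_single m]
    · simp [specialCoeff]
    · intro l _ hl
      simp [specialCoeff, hl.symm]
    · simp
  have hrow0 : ∀ i, ∑ l, specialCoeff α β 0 l * ((↑(β l)⁻¹ : A) * B l i) = ∑ l, γ l * B l i := by
    intro i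
    simp [specialCoeff, hγ, mul_assoc]
  -- The entry `(0, 0)` is where the hypothesis on the commutators enters.
  have h00 : ∑ l, γ l * B l 0 = c • (1 : A) := by
    have e1 : ∑ l, γ l * B l 0 = -∑ l, ∑ m, γ l * γ m * T m l := by
      simp [hB, hr, Finset.mul_sum, mul_assoc]
    have e2 : ∑ l, ∑ m, γ l * γ m * T m l =
        c • (∑ l, γ l ^ 2) - c • ∑ l, ∑ m, γ l * γ m * S l m := by
      have : ∀ l m, T m l = c • (if l = m then 1 else 0) - c • S l m := fun l m => by
        rw [hT]
        dsimp only
        rw [hS m l, smul_add, smul_neg, ← sub_eq_add_neg]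
        simp only [eq_comm]
      simp_rw [this, mul_sub, Finset.sum_sub_distrib, mul_smul_comm, Finset.smul_sum]
      simp [sq]
    rw [e1, e2, ← hsum, ← smul_sub, ← smul_neg]
    congr 1
    abel
  intro i j
  simp only [Matrix.of_apply]
  refine Fin.cases ?_ (fun i => ?_) i <;> refine Fin.cases ?_ (fun j => ?_) j
  · rw [hrow0, h00, if_pos rfl, ← two_smul ℝ, smul_smul]
  · rw [hrow0, hrow, if_neg (Fin.succ_ne_zero j).symm]
    simp [hB, hr]
  · rw [hrow0, hrow, if_neg (Fin.succ_ne_zero i)]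
    simp [hB, hr]
  · rw [hrow, hrow]
    simpa [hB] using hTT i j

end SpecialCoefficients

end CauchyAlgebra

theorem mainTheorem3 {A : Type*} [NormedRing A] [NormedAlgebra ℝ A] [FiniteDimensional ℝ A]
    (p : ℕ) (α : Fin p → A) (β : Fin p → Aˣ)
    (h : 1 + ∑ m : Fin p, (α m * (↑(β m)⁻¹ : A)) ^ 2 ∈
      CauchyAlgebra.commutatorRightIdeal (fun m : Fin p => α m * (↑(β m)⁻¹ : A))) :
    CauchyAlgebra.HasCauchyFormula (CauchyAlgebra.specialCoeff α β) := by
  obtain ⟨b, hb⟩ := CauchyAlgebra.exists_isConformalPair_specialCoeff α β h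
    (CauchyAlgebra.kernelConst (p + 1))
  exact CauchyAlgebra.hasCauchyFormula_of_isConformalPair p.succ_ne_zero hb
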